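/- Let $\mathbb{H}=\{x=x_0+x_1i+x_2j+x_3k\}$ be the real quaternions, $n(x)=x\bar x$ the reduced norm, $|x|=n(x)^2$, $dx=4\,dx_0dx_1dx_2dx_3$. For $g\in\mathbb{H}^\times$ let $L_1(g)$ and $R_1(g)$ be the unitary operators on $L^2(\mathbb{H},dx)$ given by $$(L_1(g)\varphi)(x)=|g|^{1/2}\varphi(xg),\qquad (R_1(g)\varphi)(x)=|g|^{1/2}\varphi(gx).$$ Let $G_0=\{g\in\mathbb{H}: n(g)=1\}$, with normalized Haar measure $d^*g_0$. Write $x=a+bj$ with $a=x_0+x_1i$, $b=x_2+x_3i$, and let $A:x\mapsto a$, $B:x\mapsto b$. For $N\ge 0$ let $V_N$ be the space of homogeneous polynomials of degree $N$ in $A,B$ with complex coefficients, on which $g\in G_0$ acts through $\alpha(y)\mapsto\alpha(yg)$ for $\alpha=A,B$; it is an irreducible representation of $G_0$. Let $W_N\subset L^2(G_0,d^*g_0)$ be the isotypical component of type $V_N$ for the action $F(x)\mapsto F(xg)$ of $G_0$, i.e. the sum of the images of all $G_0$-equivariant linear maps $V_N\to L^2(G_0,d^*g_0)$. For $F\in L^2(G_0,d^*g_0)$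 and $G\in L^2((0,\infty),\frac{du}{u})$ let $F\otimes G\in L^2(\mathbb{H},dx)$ be the function $$x\mapsto (2\pi^2|x|)^{-1/2}\,F\!\left(\frac{x}{|x|^{1/4}}\right)G(|x|),$$ and let $L^2((0,\infty),\frac{du}{u})\otimes W_N$ denote the closed linear span in $L^2(\mathbb{H},dx)$ of all $F\otimes G$ with $F\in W_N$ and $G\in L^2((0,\infty),\frac{du}{u})$. Then: 1. $L^2(\mathbb{H},dx)$ is the orthogonal Hilbert sum of the components $L^2((0,\infty),\frac{du}{u})\otimes W_N$, $N\ge 0$. 2. The set $\mathcal{A}$ of bounded operators on $L^2(\mathbb{H},dx)$ that commute with $L_1(g)$ and $R_1(g)$ for all $g\in\mathbb{H}^\times$ is an abelian von Neumann algebra. 3. For every $M\in\mathcal{A}$ and every $N\ge 0$ there is an essentially bounded function $a_N(\tau)$ on $\mathbb{R}$, unique among essentially bounded functions up to equality almost everywhere, such that for every $\psi\in L^2(\mathbb{R},\frac{d\tau}{2\pi})$, with $$G_1(u)=\mathop{\rm l.i.m.}_{\Lambda\to\infty}\int_{-\Lambda}^{\Lambda}\psi(\tau)u^{-i\tau}\frac{d\tau}{2\pi},\qquad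 G_2(u)=\mathop{\rm l.i.m.}_{\Lambda\to\infty}\int_{-\Lambda}^{\Lambda}a_N(\tau)\psi(\tau)u^{-i\tau}\frac{d\tau}{2\pi}$$ (limits in $L^2((0,\infty),\frac{du}{u})$), one has $M(F\otimes G_1)=F\otimes G_2$ for all $F\in W_N$. -/

import Mathlib

open MeasureTheory Filter Topology
open scoped Quaternion ENNReal ComplexConjugate

noncomputable section

namespace QuaternionTate

/-! ### The Hilbert space of the quaternions -/

instance : MeasurableSpace ℍ[ℝ] := borel ℍ[ℝ]

instance : BorelSpace ℍ[ℝ] := ⟨rfl⟩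

/-- The additive Haar measure `dx = 4 dx₀ dx₁ dx₂ dx₃` on the quaternions. (The Euclidean norm of
Mathlib on `ℍ[ℝ]` is the square root of the reduced norm, and `volume` is the Lebesgue measure.) -/
def dx : Measure ℍ[ℝ] := (4 : ℝ≥0∞) • volume

/-- The complex Hilbert space `L²(ℍ, dx)`. -/
abbrev L2H : Type := Lp ℂ 2 dx

/-- The module `|x| = n(x)²` of a quaternion, where `n(x) = x x̄` is the reduced norm. -/
def modulus (x : ℍ[ℝ]) : ℝ := Quaternion.normSq x ^ 2

theorem modulus_eq (x : ℍ[ℝ]) : modulus x = ‖x‖ ^ 4 := by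
  rw [modulus, Quaternion.normSq_eq_norm_mul_self]; ring

theorem modulus_pos {x : ℍ[ℝ]} (hx : x ≠ 0) : 0 < modulus x := by
  rw [modulus_eq]; have := norm_pos_iff.2 hx; positivity

theorem G₀ne (g : Metric.sphere (0 : ℍ[ℝ]) 1) : (g : ℍ[ℝ]) ≠ 0 :=
  ne_zero_of_mem_unit_sphere g

/-- Right multiplication by a unit quaternion as a linear isometry. -/
def mulRightIso (g : Metric.sphere (0 : ℍ[ℝ]) 1) : ℍ[ℝ] ≃ₗᵢ[ℝ] ℍ[ℝ] where
  toFun x := x * g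
  invFun x := x * (g⁻¹ : Metric.sphere (0 : ℍ[ℝ]) 1)
  map_add' x y := add_mul x y _
  map_smul' r x := smul_mul_assoc r x _
  left_inv x := by simp [G₀ne g]
  right_inv x := by simp [G₀ne g]
  norm_map' x := by simp

/-- Left multiplication by a unit quaternion as a linear isometry. -/
def mulLeftIso (g : Metric.sphere (0 : ℍ[ℝ]) 1) : ℍ[ℝ] ≃ₗᵢ[ℝ] ℍ[ℝ] where
  toFun x := g * x
  invFun x := (g⁻¹ : Metric.sphere (0 : ℍ[ℝ]) 1) * x
  map_add' x y := mul_add _ x y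
  map_smul' r x := mul_smul_comm r _ x
  left_inv x := by simp [G₀ne g]
  right_inv x := by simp [G₀ne g]
  norm_map' x := by simp

theorem norm_direction (x : ℍ[ℝ]) : ‖if ‖x‖ = 0 then (1 : ℍ[ℝ]) else ‖x‖⁻¹ • x‖ = 1 := by
  split_ifs with h
  · simp
  · simp [norm_smul, h]

/-- The direction `x / |x|^{1/4} = x / ‖x‖` of a nonzero quaternion, an element of the group
`G₀ = {g | n(g) = 1}`; the value at `0` is irrelevant. -/
def direction (x : ℍ[ℝ]) : Metric.sphere (0 : ℍ[ℝ]) 1 :=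
  ⟨if ‖x‖ = 0 then 1 else ‖x‖⁻¹ • x, by simpa using norm_direction x⟩

theorem norm_smul_direction (x : ℍ[ℝ]) : ‖x‖ • (direction x : ℍ[ℝ]) = x := by
  by_cases h : x = 0
  · simp [h]
  · have := norm_ne_zero_iff.2 h
    simp only [direction, this, if_false]
    rw [smul_smul, mul_inv_cancel₀ this, one_smul]

theorem map_smul_iso (e : ℍ[ℝ] ≃ₗᵢ[ℝ] ℍ[ℝ]) {r : ℝ} (hr : 0 < r) :
    Measure.map (fun x => r • e x) dx = ENNReal.ofReal (r ^ 4)⁻¹ • dx := by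
  have h : Measure.map (fun x => r • e x) (volume : Measure ℍ[ℝ])
      = ENNReal.ofReal (r ^ 4)⁻¹ • volume := by
    have h1 : (fun x => r • e x) = (r • ·) ∘ e := rfl
    rw [h1, ← Measure.map_map (by fun_prop) e.continuous.measurable,
      e.measurePreserving.map_eq, Measure.map_addHaar_smul _ hr.ne',
      Quaternion.finrank_eq_four, abs_of_pos (by positivity)]
  rw [dx, Measure.map_smul, h, smul_comm]

/-- The module is the factor by which right multiplication scales the additive Haar measure. -/
theorem map_mul_right (g : ℍ[ℝ]ˣ) :
    Measure.map (fun x => x * (g : ℍ[ℝ])) dx = ENNReal.ofReal (modulus g)⁻¹ • dx := by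
  rw [modulus_eq, ← map_smul_iso (mulRightIso (direction g)) (norm_pos_iff.2 g.ne_zero)]
  congr 1
  ext1 x
  conv_lhs => rw [← norm_smul_direction (g : ℍ[ℝ])]
  exact mul_smul_comm _ _ _

/-- The module is the factor by which left multiplication scales the additive Haar measure. -/
theorem map_mul_left (g : ℍ[ℝ]ˣ) :
    Measure.map (fun x => (g : ℍ[ℝ]) * x) dx = ENNReal.ofReal (modulus g)⁻¹ • dx := by
  rw [modulus_eq, ← map_smul_iso (mulLeftIso (direction g)) (norm_pos_iff.2 g.ne_zero)]
  congr 1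
  ext1 x
  conv_lhs => rw [← norm_smul_direction (g : ℍ[ℝ])]
  exact smul_mul_assoc _ _ _

/-! ### The actions of the multiplicative group -/

section weighted

variable {m : ℝ} {f : ℍ[ℝ] → ℍ[ℝ]}

theorem quasi_of_map (hf : Measurable f)
    (hmap : Measure.map f dx = ENNReal.ofReal m⁻¹ • dx) :
    Measure.QuasiMeasurePreserving f dx dx :=
  ⟨hf, by rw [hmap]; exact Measure.smul_absolutelyContinuous⟩

theorem memLp_weighted (hf : Measurable f)
    (hmap : Measure.map f dx = ENNReal.ofReal m⁻¹ • dx) (φ : L2H) :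
    MemLp (fun x => (Real.sqrt m : ℂ) * φ (f x)) 2 dx := by
  have h : MemLp φ 2 (Measure.map f dx) := by
    rw [hmap]; exact (Lp.memLp φ).smul_measure ENNReal.ofReal_ne_top
  exact (h.comp_of_map hf.aemeasurable).const_mul _

theorem eLpNorm_weighted (hm : 0 < m) (hf : Measurable f)
    (hmap : Measure.map f dx = ENNReal.ofReal m⁻¹ • dx) (φ : L2H) :
    eLpNorm (fun x => (Real.sqrt m : ℂ) * φ (f x)) 2 dx = eLpNorm φ 2 dx := by
  have h : AEStronglyMeasurable φ (Measure.map f dx) := by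
    rw [hmap]; exact (Lp.aestronglyMeasurable φ).smul_measure _
  have e : (fun x => (Real.sqrt m : ℂ) * φ (f x)) = (Real.sqrt m : ℂ) • ((φ : ℍ[ℝ] → ℂ) ∘ f) := rfl
  rw [e, eLpNorm_const_smul, ← eLpNorm_map_measure h hf.aemeasurable, hmap,
    eLpNorm_smul_measure_of_ne_top (by simp), smul_eq_mul, ← mul_assoc]
  have hs : ‖(Real.sqrt m : ℂ)‖ₑ = ENNReal.ofReal (Real.sqrt m) := by
    rw [← ofReal_norm, Complex.norm_real, Real.norm_of_nonneg (Real.sqrt_nonneg _)]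
  have ht : ENNReal.ofReal m⁻¹ ^ (1 / 2 : ℝ≥0∞).toReal = ENNReal.ofReal (Real.sqrt m)⁻¹ := by
    rw [← Real.sqrt_inv, Real.sqrt_eq_rpow, ENNReal.ofReal_rpow_of_pos (by positivity)]
    norm_num
  rw [hs, ht, ← ENNReal.ofReal_mul (Real.sqrt_nonneg _),
    mul_inv_cancel₀ (Real.sqrt_pos.2 hm).ne', ENNReal.ofReal_one, one_mul]

/-- The isometry `φ ↦ m^{1/2} φ ∘ f` of `L²(ℍ, dx)`, for a map `f` with `d(f(x)) = m dx`. -/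
def weightedComp (hm : 0 < m) (hf : Measurable f)
    (hmap : Measure.map f dx = ENNReal.ofReal m⁻¹ • dx) : L2H →ₗᵢ[ℂ] L2H where
  toFun φ := (memLp_weighted hf hmap φ).toLp _
  map_add' φ ψ := by
    rw [← MemLp.toLp_add]
    refine MemLp.toLp_congr _ _ ?_
    filter_upwards [(quasi_of_map hf hmap).ae (Lp.coeFn_add φ ψ)] with x hx
    simp only [hx, Pi.add_apply, mul_add]
  map_smul' c φ := by
    rw [← MemLp.toLp_const_smul]
    refine MemLp.toLp_congr _ _ ?_
    filter_upwards [(quasi_of_map hf hmap).ae (Lp.coeFn_smul c φ)] with x hx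
    simp [hx, mul_left_comm]
  norm_map' φ := by
    simp only [LinearMap.coe_mk, AddHom.coe_mk]
    rw [Lp.norm_toLp, eLpNorm_weighted hm hf hmap, Lp.norm_def]

end weighted

/-- The unitary operator `L₁(g) : φ(x) ↦ |g|^{1/2} φ(xg)` on `L²(ℍ, dx)`. -/
def L₁ (g : ℍ[ℝ]ˣ) : L2H →L[ℂ] L2H :=
  (weightedComp (modulus_pos g.ne_zero) (continuous_mul_const (g : ℍ[ℝ])).measurable
    (map_mul_right g)).toContinuousLinearMap

/-- The unitary operator `R₁(g) : φ(x) ↦ |g|^{1/2} φ(gx)` on `L²(ℍ, dx)`. -/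
def R₁ (g : ℍ[ℝ]ˣ) : L2H →L[ℂ] L2H :=
  (weightedComp (modulus_pos g.ne_zero) (continuous_const_mul (g : ℍ[ℝ])).measurable
    (map_mul_left g)).toContinuousLinearMap

theorem L₁_apply (g : ℍ[ℝ]ˣ) (φ : L2H) :
    L₁ g φ =ᵐ[dx] fun x => (Real.sqrt (modulus g) : ℂ) * φ (x * g) :=
  MemLp.coeFn_toLp (memLp_weighted (continuous_mul_const (g : ℍ[ℝ])).measurable
    (map_mul_right g) φ)

theorem R₁_apply (g : ℍ[ℝ]ˣ) (φ : L2H) :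
    R₁ g φ =ᵐ[dx] fun x => (Real.sqrt (modulus g) : ℂ) * φ (g * x) :=
  MemLp.coeFn_toLp (memLp_weighted (continuous_const_mul (g : ℍ[ℝ])).measurable
    (map_mul_left g) φ)

/-! ### The maximal compact subgroup and the spaces `W_N` -/

/-- The group `G₀ = {g ∈ ℍ | n(g) = 1}` of unit quaternions (with the group structure of Mathlib on
the unit sphere of a normed division ring). -/
abbrev G₀ : Type := Metric.sphere (0 : ℍ[ℝ]) 1

/-- The normalized Haar measure `d*g₀ = dσ / 2π²` of `G₀`, where `dσ` is the Euclidean surface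
measure of the unit sphere, of total mass `2π²`. -/
def haarG₀ : Measure G₀ :=
  ENNReal.ofReal (2 * Real.pi ^ 2)⁻¹ • (volume : Measure ℍ[ℝ]).toSphere

open scoped Pointwise in
theorem image_mul_right (g : G₀) (s : Set G₀) :
    mulRightIso g ⁻¹' (Set.Ioo (0 : ℝ) 1 • ((↑) '' s : Set ℍ[ℝ])) =
      Set.Ioo (0 : ℝ) 1 • ((↑) '' ((fun x => x * g) ⁻¹' s) : Set ℍ[ℝ]) := by
  ext x
  simp only [Set.mem_preimage, Set.mem_smul, Set.mem_image]
  constructor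
  · rintro ⟨r, hr, _, ⟨y, hy, rfl⟩, h⟩
    refine ⟨r, hr, _, ⟨y * g⁻¹, by simpa using hy, rfl⟩, ?_⟩
    apply (mulRightIso g).injective
    rw [map_smul, ← h]
    congr 1
    change ((y * g⁻¹ : G₀) : ℍ[ℝ]) * (g : ℍ[ℝ]) = y
    rw [← Metric.unitSphere.coe_mul, inv_mul_cancel_right]
  · rintro ⟨r, hr, _, ⟨y, hy, rfl⟩, rfl⟩
    refine ⟨r, hr, _, ⟨y * g, hy, rfl⟩, ?_⟩
    rw [map_smul]
    rfl

theorem measurePreserving_mul_right (g : G₀) :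
    MeasurePreserving (fun x : G₀ => x * g) haarG₀ haarG₀ := by
  have hm : Measurable (fun x : G₀ => x * g) := (continuous_mul_const g).measurable
  have h : MeasurePreserving (fun x : G₀ => x * g) (volume : Measure ℍ[ℝ]).toSphere
      (volume : Measure ℍ[ℝ]).toSphere := by
    refine ⟨hm, ?_⟩
    ext s hs
    rw [Measure.map_apply hm hs, Measure.toSphere_apply' _ hs, Measure.toSphere_apply' _ (hm hs),
      ← image_mul_right, (mulRightIso g).measurePreserving.measure_preimage_emb
        (mulRightIso g).toHomeomorph.measurableEmbedding]
  exact h.smul_measure _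

/-- The Hilbert space `L²(G₀, d*g₀)`. -/
abbrev L2G₀ : Type := Lp ℂ 2 haarG₀

/-- The unitary operator `F(x) ↦ F(xg)` on `L²(G₀, d*g₀)`. -/
def rightTranslation (g : G₀) : L2G₀ →ₗᵢ[ℂ] L2G₀ :=
  Lp.compMeasurePreservingₗᵢ ℂ (fun x => x * g) (measurePreserving_mul_right g)

/-- Writing `g = a + b j` with `a = x₀ + x₁ i`, `b = x₂ + x₃ i`, this is the algebra endomorphism
`α(y) ↦ α(yg)` of the algebra of complex polynomials in the two coordinates `A : y ↦ a(y)` (the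
variable `X 0`) and `B : y ↦ b(y)` (the variable `X 1`) of a quaternion `y`:
`A ↦ a A - b̄ B` and `B ↦ b A + ā B`. -/
def substitution (g : ℍ[ℝ]) : MvPolynomial (Fin 2) ℂ →ₐ[ℂ] MvPolynomial (Fin 2) ℂ :=
  MvPolynomial.aeval
    ![MvPolynomial.C (⟨g.re, g.imI⟩ : ℂ) * MvPolynomial.X 0
        - MvPolynomial.C (conj (⟨g.imJ, g.imK⟩ : ℂ)) * MvPolynomial.X 1,
      MvPolynomial.C (⟨g.imJ, g.imK⟩ : ℂ) * MvPolynomial.X 0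
        + MvPolynomial.C (conj (⟨g.re, g.imI⟩ : ℂ)) * MvPolynomial.X 1]

/-- The space `V_N = SYM^N(V)`, with basis the monomials `A^j B^{N-j}`, `0 ≤ j ≤ N`. -/
abbrev V (N : ℕ) : Submodule ℂ (MvPolynomial (Fin 2) ℂ) :=
  MvPolynomial.homogeneousSubmodule (Fin 2) ℂ N

theorem substitution_mem (g : ℍ[ℝ]) (N : ℕ) (v : MvPolynomial (Fin 2) ℂ) (hv : v ∈ V N) :
    substitution g v ∈ V N := by
  have h := (MvPolynomial.mem_homogeneousSubmodule N v).1 hv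
  have hC : ∀ (c : ℂ) (i : Fin 2), (MvPolynomial.C c * MvPolynomial.X i
      : MvPolynomial (Fin 2) ℂ).IsHomogeneous 1 := fun c i => by
    simpa using (MvPolynomial.isHomogeneous_C (Fin 2) c).mul (MvPolynomial.isHomogeneous_X ℂ i)
  refine (MvPolynomial.mem_homogeneousSubmodule N _).2 ?_
  rw [← one_mul N]
  refine h.aeval _ ?_
  intro i
  fin_cases i
  · exact (hC _ _).sub (hC _ _)
  · exact (hC _ _).add (hC _ _)

/-- The action of a quaternion on `V_N`. -/
def actV (N : ℕ) (g : ℍ[ℝ]) : V N →ₗ[ℂ] V N :=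
  (substitution g).toLinearMap.restrict (substitution_mem g N)

/-- The space `W_N`: the isotypical component of type `V_N` of `L²(G₀, d*g₀)` under the action
`F(x) ↦ F(xg)` of `G₀`, that is the sum of the images of all the `G₀`-equivariant linear maps from
the irreducible representation `V_N` to `L²(G₀, d*g₀)`. -/
def W (N : ℕ) : Submodule ℂ L2G₀ :=
  ⨆ (T : V N →ₗ[ℂ] L2G₀) (_ : ∀ (g : G₀) (v : V N), T (actV N g v) = rightTranslation g (T v)),
    LinearMap.range T

/-! ### The multiplicative half-line -/

/-- The measure `du/u` on `(0, ∞)`, as a measure on `ℝ`. -/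
def duu : Measure ℝ :=
  (volume.restrict (Set.Ioi (0 : ℝ))).withDensity fun u => ENNReal.ofReal u⁻¹

/-- The Hilbert space `L²((0, ∞), du/u)`. -/
abbrev L2R : Type := Lp ℂ 2 duu

/-- The measure `dτ / 2π` on `ℝ`. -/
def dτ : Measure ℝ := ENNReal.ofReal (2 * Real.pi)⁻¹ • volume

/-- `G(u) = l.i.m._{Λ → ∞} ∫_{-Λ}^{Λ} ψ(τ) u^{-iτ} dτ / 2π`, the limit being taken in the norm of
`L²((0, ∞), du/u)`. -/
def IsMellinLim (ψ : ℝ → ℂ) (G : L2R) : Prop :=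
  Tendsto (fun Λ : ℝ =>
      eLpNorm (fun u : ℝ => G u - ∫ τ in (-Λ)..Λ, ψ τ * (u : ℂ) ^ (-(τ * Complex.I)) ∂dτ) 2 duu)
    atTop (𝓝 0)

/-! ### The components of `L²(ℍ, dx)` -/

/-- The function `x ↦ (2π²|x|)^{-1/2} F(x / |x|^{1/4}) G(|x|)`. -/
def tensorFun (F : L2G₀) (G : L2R) (x : ℍ[ℝ]) : ℂ :=
  ((Real.sqrt (2 * Real.pi ^ 2 * modulus x) : ℝ) : ℂ)⁻¹ * (F (direction x) * G (modulus x))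

theorem measurable_direction : Measurable direction := by
  refine Measurable.subtype_mk ?_
  exact Measurable.ite (measurableSet_eq_fun measurable_norm measurable_const) measurable_const
    (measurable_norm.inv.smul measurable_id)

theorem measurable_modulus : Measurable modulus := by
  have : modulus = fun x => ‖x‖ ^ 4 := funext modulus_eq
  rw [this]; fun_prop

theorem measurable_tensorFun (F : L2G₀) (G : L2R) : Measurable (tensorFun F G) := by
  have hF : Measurable F := (Lp.stronglyMeasurable F).measurable
  have hG : Measurable G := (Lp.stronglyMeasurable G).measurable
  have h1 := hF.comp measurable_direction
  have h2 := hG.comp measurable_modulus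
  have h3 := measurable_modulus
  unfold tensorFun
  exact (by fun_prop : Measurable fun x : ℍ[ℝ] =>
    ((Real.sqrt (2 * Real.pi ^ 2 * modulus x) : ℝ) : ℂ)⁻¹).mul (h1.mul h2)

theorem lintegral_polar (p : G₀ → ℝ≥0∞) (q : ℝ → ℝ≥0∞) (hp : Measurable p) (hq : Measurable q) :
    ∫⁻ x : ℍ[ℝ], p (direction x) * q ‖x‖ =
      (∫⁻ s, p s ∂(volume : Measure ℍ[ℝ]).toSphere) *
        ∫⁻ r in Set.Ioi (0 : ℝ), ENNReal.ofReal (r ^ 3) * q r := by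
  have hd : ∀ x : ({0}ᶜ : Set ℍ[ℝ]), direction x = (homeomorphUnitSphereProd ℍ[ℝ] x).1 := by
    intro x
    have hx : ‖(x : ℍ[ℝ])‖ ≠ 0 := norm_ne_zero_iff.2 x.2
    apply Subtype.ext
    simp only [direction, hx, if_false, homeomorphUnitSphereProd_apply_fst_coe]
  have hn : ∀ x : ({0}ᶜ : Set ℍ[ℝ]), ‖(x : ℍ[ℝ])‖ = (homeomorphUnitSphereProd ℍ[ℝ] x).2 := by
    intro x
    simp only [homeomorphUnitSphereProd_apply_snd_coe]
  have hmp := (volume : Measure ℍ[ℝ]).measurePreserving_homeomorphUnitSphereProd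
  have hq' : Measurable fun r : Set.Ioi (0 : ℝ) => q r := hq.comp measurable_subtype_coe
  have h3 : Measurable fun r : ℝ => ENNReal.ofReal (r ^ 3) := by fun_prop
  conv_lhs => rw [← restrict_compl_singleton (μ := (volume : Measure ℍ[ℝ])) 0]
  rw [← lintegral_subtype_comap (measurableSet_singleton (0 : ℍ[ℝ])).compl]
  simp_rw [hd, hn]
  rw [hmp.lintegral_comp (f := fun z : G₀ × Set.Ioi (0 : ℝ) => p z.1 * q z.2)
    ((hp.comp measurable_fst).mul (hq'.comp measurable_snd)),
    lintegral_prod_mul hp.aemeasurable hq'.aemeasurable, Quaternion.finrank_eq_four,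
    Measure.volumeIoiPow, lintegral_withDensity_eq_lintegral_mul _
      (f := fun r : Set.Ioi (0 : ℝ) => ENNReal.ofReal ((r : ℝ) ^ (4 - 1)))
      (h3.comp measurable_subtype_coe) hq']
  congr 1
  exact lintegral_subtype_comap measurableSet_Ioi (fun r : ℝ => ENNReal.ofReal (r ^ 3) * q r)

theorem lintegral_radial (k : ℝ → ℝ≥0∞) (hk : Measurable k) :
    ∫⁻ r in Set.Ioi (0 : ℝ), ENNReal.ofReal (4 * r ^ 3) * (ENNReal.ofReal (r ^ 4)⁻¹ * k (r ^ 4)) =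
      ∫⁻ u, k u ∂duu := by
  have h1 : Measurable fun u : ℝ => ENNReal.ofReal u⁻¹ := by fun_prop
  rw [duu, lintegral_withDensity_eq_lintegral_mul _ h1 hk]
  have himg : (fun r : ℝ => r ^ 4) '' Set.Ioi 0 = Set.Ioi 0 := by
    ext u
    constructor
    · rintro ⟨r, hr, rfl⟩
      exact pow_pos (Set.mem_Ioi.1 hr) 4
    · intro hu
      have hu : 0 < u := hu
      refine ⟨u ^ (1 / 4 : ℝ), Real.rpow_pos_of_pos hu _, ?_⟩
      simp only
      rw [← Real.rpow_natCast, ← Real.rpow_mul hu.le]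
      norm_num
  have hinj : Set.InjOn (fun r : ℝ => r ^ 4) (Set.Ioi 0) := fun a ha b hb h =>
    (pow_left_inj₀ (le_of_lt ha) (le_of_lt hb) (by norm_num)).1 h
  have hder : ∀ r ∈ Set.Ioi (0 : ℝ),
      HasDerivWithinAt (fun r : ℝ => r ^ 4) (4 * r ^ 3) (Set.Ioi 0) r := fun r _ => by
    simpa using (hasDerivAt_pow 4 r).hasDerivWithinAt
  have h := lintegral_image_eq_lintegral_abs_deriv_mul measurableSet_Ioi hder hinj
    (fun u => ENNReal.ofReal u⁻¹ * k u)
  rw [himg] at h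
  refine Eq.trans ?_ h.symm
  refine setLIntegral_congr_fun measurableSet_Ioi fun r hr => ?_
  have hr : 0 < r := hr
  rw [abs_of_pos (by positivity)]

theorem memLp_tensorFun (F : L2G₀) (G : L2R) : MemLp (tensorFun F G) 2 dx := by
  refine ⟨(measurable_tensorFun F G).aestronglyMeasurable, ?_⟩
  have hF : Measurable F := (Lp.stronglyMeasurable F).measurable
  have hG : Measurable G := (Lp.stronglyMeasurable G).measurable
  have hF2 : ∫⁻ s, ‖F s‖ₑ ^ 2 ∂haarG₀ < ∞ := by
    have h := (Lp.memLp F).2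
    simpa using lintegral_rpow_enorm_lt_top_of_eLpNorm_lt_top (by simp) (by simp) h
  have hG2 : ∫⁻ u, ‖G u‖ₑ ^ 2 ∂duu < ∞ := by
    have h := (Lp.memLp G).2
    simpa using lintegral_rpow_enorm_lt_top_of_eLpNorm_lt_top (by simp) (by simp) h
  have hpi : 0 < (2 * Real.pi ^ 2)⁻¹ := by positivity
  have hF3 : ∫⁻ s, ‖F s‖ₑ ^ 2 ∂(volume : Measure ℍ[ℝ]).toSphere < ∞ := by
    change ∫⁻ s, ‖F s‖ₑ ^ 2 ∂(ENNReal.ofReal (2 * Real.pi ^ 2)⁻¹ •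
      (volume : Measure ℍ[ℝ]).toSphere) < ∞ at hF2
    rw [lintegral_smul_measure, smul_eq_mul] at hF2
    exact ENNReal.lt_top_of_mul_ne_top_right hF2.ne (ENNReal.ofReal_pos.2 hpi).ne'
  rw [eLpNorm_lt_top_iff_lintegral_rpow_enorm_lt_top (by simp) (by simp)]
  have hpt : ∀ x : ℍ[ℝ], ‖tensorFun F G x‖ₑ ^ (2 : ℝ≥0∞).toReal =
      ENNReal.ofReal (2 * Real.pi ^ 2)⁻¹ * (‖F (direction x)‖ₑ ^ 2 *
        (ENNReal.ofReal (‖x‖ ^ 4)⁻¹ * ‖G (‖x‖ ^ 4)‖ₑ ^ 2)) := by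
    intro x
    have hc : ‖((Real.sqrt (2 * Real.pi ^ 2 * modulus x) : ℝ) : ℂ)⁻¹‖ₑ ^ 2 =
        ENNReal.ofReal (2 * Real.pi ^ 2)⁻¹ * ENNReal.ofReal (‖x‖ ^ 4)⁻¹ := by
      rw [← ofReal_norm, norm_inv, Complex.norm_real, Real.norm_of_nonneg (Real.sqrt_nonneg _),
        ← ENNReal.ofReal_pow (by positivity), inv_pow, modulus_eq,
        Real.sq_sqrt (by positivity), mul_inv, ENNReal.ofReal_mul hpi.le]
    rw [ENNReal.toReal_ofNat, ENNReal.rpow_ofNat, tensorFun, enorm_mul, enorm_mul, mul_pow, mul_pow,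
      hc, modulus_eq]
    ring
  simp_rw [hpt]
  have hk : Measurable fun u : ℝ => ‖G u‖ₑ ^ 2 := by fun_prop
  have hq : Measurable fun r : ℝ => ENNReal.ofReal (r ^ 4)⁻¹ * ‖G (r ^ 4)‖ₑ ^ 2 := by fun_prop
  rw [dx, lintegral_smul_measure, lintegral_const_mul' _ _ ENNReal.ofReal_ne_top,
    lintegral_polar (fun s => ‖F s‖ₑ ^ 2) _ (by fun_prop) hq]
  have hrad : ∫⁻ r in Set.Ioi (0 : ℝ),
      ENNReal.ofReal (r ^ 3) * (ENNReal.ofReal (r ^ 4)⁻¹ * ‖G (r ^ 4)‖ₑ ^ 2) < ∞ := by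
    refine lt_of_le_of_lt ?_ hG2
    rw [← lintegral_radial _ hk]
    refine setLIntegral_mono' measurableSet_Ioi fun r hr => ?_
    have hr : 0 < r ^ 3 := pow_pos hr 3
    gcongr
    linarith
  exact ENNReal.mul_lt_top (by simp) (ENNReal.mul_lt_top ENNReal.ofReal_lt_top
    (ENNReal.mul_lt_top hF3 hrad))

/-- The element of `L²(ℍ, dx)` which corresponds, under the basic isometry
`φ(x) ↦ f(g) = (2π²|g|)^{1/2} φ(g)` from `L²(ℍ, dx)` onto `L²(ℍˣ, d*g)`, to the function
`F G : g ↦ F(g / |g|^{1/4}) G(|g|)`. -/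
def tensor (F : L2G₀) (G : L2R) : L2H := (memLp_tensorFun F G).toLp _

/-- The component `L²((0, ∞), du/u) ⊗ W_N` of `L²(ℍ, dx)`: the closed linear span of the products
`F G` with `F ∈ W_N` and `G ∈ L²((0, ∞), du/u)`. -/
def component (N : ℕ) : Submodule ℂ L2H :=
  (Submodule.span ℂ {φ | ∃ F ∈ W N, ∃ G : L2R, φ = tensor F G}).topologicalClosure

end QuaternionTate

end

open QuaternionTate

noncomputable section

namespace QuaternionTate

/-! ### Polar coordinates -/

/-! In the polar coordinates `x ↦ (direction x, modulus x)` the measure `dx`, divided by `2π²|x|`,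
becomes the product of `haarG₀` and `duu`. Hence `(F, G) ↦ tensor F G` realizes `L²(ℍ, dx)` as the
Hilbert tensor product of `L²(G₀)` and `L²((0, ∞), du/u)` (`inner_tensor`,
`eq_zero_of_inner_tensor`). Unit quaternions act on the first factor by translations, positive real
scalars act on the second by dilations.

The first factor is governed by Peter–Weyl for `SU(2)`, made explicit. The row vector `(c, 1)` times
the matrix of `x` is `(cA - B̄, cB + Ā)`, and the coefficients of `c^i` in `(cA - B̄)^k (cB + Ā)^l`
with `k + l = N` are matrix coefficients of `V_N`. Their span over all `i`, `k`, `l` contains the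
algebra generated by `A`, `B`, `Ā`, `B̄` (`adjoin_le_formSpan`), so Stone–Weierstrass makes them
total. Different `W_N` are orthogonal because the highest weight of `V_N` does not occur in `V_M`
for `M < N` (`inner_eq_zero_of_lt`). This gives the Hilbert sum.

An operator on `L²(G₀)` that commutes with both translations is scalar on `W_N`
(`eq_smul_of_mem_W`): it preserves the line of `(-B̄)^N`, which among the matrix coefficients is
singled out by its left and right torus weights, and the translates of that vector span a dense part
of `W_N`. Applied to the partial matrix elements `⟨F' ⊗ G', M (F ⊗ G)⟩` of an intertwining `M`, this
yields `M (F ⊗ G) = F ⊗ S G`, with `S` depending only on `N` (`map_tensor`). Such an `S` commutes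
with dilations. The Mellin transform turns dilations into multiplication by characters, whose
commutant consists of multiplications by bounded functions (`exists_mellin_multiplier`).
Multiplications commute, so the algebra is abelian, and `S` provides `a_N`. -/

instance : IsFiniteMeasure haarG₀ := by
  unfold haarG₀
  exact Measure.smul_finite _ ENNReal.ofReal_ne_top

instance : SigmaFinite duu := by
  unfold duu
  exact SigmaFinite.withDensity_ofReal _

/-- The constants match: the 4 in `dx` supplies the Jacobian of `u = r^4`, where `du = 4 r^3 dr`,
and `2π²` is the area of the sphere by which `haarG₀` is normalized. -/
theorem lintegral_polar_mul (p : G₀ → ℝ≥0∞) (q : ℝ → ℝ≥0∞) (hp : Measurable p)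
    (hq : Measurable q) :
    ∫⁻ x, ENNReal.ofReal (2 * Real.pi ^ 2 * modulus x)⁻¹ * (p (direction x) * q (modulus x)) ∂dx =
      (∫⁻ s, p s ∂haarG₀) * ∫⁻ u, q u ∂duu := by
  have hpi : 0 < (2 * Real.pi ^ 2)⁻¹ := by positivity
  have h1 : ∀ x : ℍ[ℝ],
      ENNReal.ofReal (2 * Real.pi ^ 2 * modulus x)⁻¹ * (p (direction x) * q (modulus x)) =
      ENNReal.ofReal (2 * Real.pi ^ 2)⁻¹ *
        (p (direction x) * (ENNReal.ofReal (‖x‖ ^ 4)⁻¹ * q (‖x‖ ^ 4))) := by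
    intro x
    rw [modulus_eq, mul_inv, ENNReal.ofReal_mul hpi.le]
    ring
  have hq' : Measurable fun r : ℝ => ENNReal.ofReal (r ^ 4)⁻¹ * q (r ^ 4) := by fun_prop
  have h4 : ∀ r ∈ Set.Ioi (0 : ℝ), ENNReal.ofReal (4 * r ^ 3) * (ENNReal.ofReal (r ^ 4)⁻¹ * q (r ^ 4))
      = 4 * (ENNReal.ofReal (r ^ 3) * (ENNReal.ofReal (r ^ 4)⁻¹ * q (r ^ 4))) := by
    intro r _
    rw [ENNReal.ofReal_mul (by norm_num), mul_assoc]
    norm_num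
  simp_rw [h1]
  rw [dx, lintegral_smul_measure, lintegral_const_mul' _ _ ENNReal.ofReal_ne_top,
    lintegral_polar p _ hp hq', ← lintegral_radial q hq, setLIntegral_congr_fun measurableSet_Ioi h4,
    lintegral_const_mul' _ _ (by simp), haarG₀, lintegral_smul_measure]
  simp only [smul_eq_mul]
  ring

/-- Polar coordinates `x ↦ (x / |x|^{1/4}, |x|)` on the quaternions. -/
def polar (x : ℍ[ℝ]) : G₀ × ℝ := (direction x, modulus x)

theorem measurable_polar : Measurable polar := measurable_direction.prodMk measurable_modulus

/-- The density of the multiplicative measure with respect to `dx`. -/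
def polarDensity (x : ℍ[ℝ]) : ℝ≥0∞ := ENNReal.ofReal (2 * Real.pi ^ 2 * modulus x)⁻¹

theorem measurable_polarDensity : Measurable polarDensity := by
  have := measurable_modulus
  unfold polarDensity
  fun_prop

theorem map_polar : Measure.map polar (dx.withDensity polarDensity) = haarG₀.prod duu := by
  refine (Measure.prod_eq fun s t hs ht => ?_).symm
  rw [Measure.map_apply measurable_polar (hs.prod ht),
    withDensity_apply _ (measurable_polar (hs.prod ht)),
    ← lintegral_indicator (measurable_polar (hs.prod ht))]
  have h := lintegral_polar_mul (s.indicator 1) (t.indicator 1) (measurable_one.indicator hs)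
    (measurable_one.indicator ht)
  rw [lintegral_indicator_one hs, lintegral_indicator_one ht] at h
  rw [← h]
  congr 1
  ext x
  by_cases h1 : direction x ∈ s <;> by_cases h2 : modulus x ∈ t <;>
    simp [polar, Set.indicator, h1, h2, polarDensity]

theorem ae_ne_zero : ∀ᵐ x ∂dx, x ≠ 0 := by
  have h : ∀ᵐ x ∂(volume : Measure ℍ[ℝ]), x ≠ 0 := Measure.ae_ne volume 0
  exact Measure.ae_smul_measure h _

/-- The density is positive off the null set `{0}`, so `dx` is absolutely continuous with respect to
the weighted measure. This allows almost everywhere identities on either factor to be pulled back to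
`ℍ`. -/
theorem quasi_polar : Measure.QuasiMeasurePreserving polar dx (haarG₀.prod duu) := by
  refine ⟨measurable_polar, ?_⟩
  rw [← map_polar]
  refine Measure.AbsolutelyContinuous.map ?_ measurable_polar
  refine withDensity_absolutelyContinuous' measurable_polarDensity.aemeasurable ?_
  filter_upwards [ae_ne_zero] with x hx
  have := modulus_pos hx
  simp only [polarDensity, ne_eq, ENNReal.ofReal_eq_zero, not_le]
  positivity

theorem quasi_direction : Measure.QuasiMeasurePreserving direction dx haarG₀ :=
  Measure.quasiMeasurePreserving_fst.comp quasi_polar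

theorem quasi_modulus : Measure.QuasiMeasurePreserving modulus dx duu :=
  Measure.quasiMeasurePreserving_snd.comp quasi_polar

theorem integral_polar (f : G₀ × ℝ → ℂ) (hf : AEStronglyMeasurable f (haarG₀.prod duu)) :
    ∫ x, ((2 * Real.pi ^ 2 * modulus x)⁻¹ : ℝ) • f (polar x) ∂dx = ∫ z, f z ∂(haarG₀.prod duu) := by
  rw [← map_polar] at hf ⊢
  rw [integral_map measurable_polar.aemeasurable hf,
    integral_withDensity_eq_integral_toReal_smul measurable_polarDensity (by simp [polarDensity])]
  refine integral_congr_ae (Eventually.of_forall fun x => ?_)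
  have : 0 ≤ (2 * Real.pi ^ 2 * modulus x)⁻¹ := by rw [modulus_eq]; positivity
  simp only [polarDensity, ENNReal.toReal_ofReal this]

/-! ### The tensor product decomposition -/

theorem tensor_coeFn (F : L2G₀) (G : L2R) : tensor F G =ᵐ[dx] tensorFun F G :=
  MemLp.coeFn_toLp _

/-- The factor `(2π²|x|)^{-1/2}` occurs twice in the integrand and produces exactly the polar
density, after which Fubini applies. -/
theorem inner_tensor (F F' : L2G₀) (G G' : L2R) :
    inner ℂ (tensor F G) (tensor F' G') = inner ℂ F F' * inner ℂ G G' := by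
  rw [L2.inner_def, L2.inner_def, L2.inner_def, ← integral_prod_mul, ← integral_polar]
  · refine integral_congr_ae ?_
    filter_upwards [tensor_coeFn F G, tensor_coeFn F' G'] with x h h'
    have hm : 0 ≤ 2 * Real.pi ^ 2 * modulus x := by rw [modulus_eq]; positivity
    have hs : ((Real.sqrt (2 * Real.pi ^ 2 * modulus x) : ℝ) : ℂ) ^ 2 =
        ((2 * Real.pi ^ 2 * modulus x : ℝ) : ℂ) := by
      rw [← Complex.ofReal_pow, Real.sq_sqrt hm]
    rw [h, h', Complex.real_smul, Complex.ofReal_inv, ← hs]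
    simp only [tensorFun, RCLike.inner_apply, polar, map_mul, map_inv₀, Complex.conj_ofReal]
    ring
  · have h1 : AEStronglyMeasurable (fun s => inner ℂ (F s) (F' s)) haarG₀ :=
      (Lp.aestronglyMeasurable F).inner (Lp.aestronglyMeasurable F')
    have h2 : AEStronglyMeasurable (fun s => inner ℂ (G s) (G' s)) duu :=
      (Lp.aestronglyMeasurable G).inner (Lp.aestronglyMeasurable G')
    exact h1.comp_fst.mul h2.comp_snd

theorem norm_tensor (F : L2G₀) (G : L2R) : ‖tensor F G‖ = ‖F‖ * ‖G‖ := by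
  have h := inner_tensor F F G G
  rw [inner_self_eq_norm_sq_to_K, inner_self_eq_norm_sq_to_K, inner_self_eq_norm_sq_to_K,
    ← mul_pow] at h
  norm_cast at h
  exact (pow_left_inj₀ (norm_nonneg _) (by positivity) two_ne_zero).1 h

theorem tensor_add_left (F F' : L2G₀) (G : L2R) :
    tensor (F + F') G = tensor F G + tensor F' G := by
  refine Lp.ext ?_
  filter_upwards [tensor_coeFn (F + F') G, tensor_coeFn F G, tensor_coeFn F' G,
    Lp.coeFn_add (tensor F G) (tensor F' G), quasi_direction.ae (Lp.coeFn_add F F')]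
    with x h1 h2 h3 h4 h5
  rw [h1, h4, Pi.add_apply, h2, h3]
  simp only [tensorFun, h5, Pi.add_apply]
  ring

theorem tensor_smul_left (c : ℂ) (F : L2G₀) (G : L2R) : tensor (c • F) G = c • tensor F G := by
  refine Lp.ext ?_
  filter_upwards [tensor_coeFn (c • F) G, tensor_coeFn F G,
    Lp.coeFn_smul c (tensor F G), quasi_direction.ae (Lp.coeFn_smul c F)] with x h1 h2 h3 h4
  rw [h1, h3, Pi.smul_apply, h2]
  simp only [tensorFun, h4, Pi.smul_apply, smul_eq_mul]
  ring

theorem tensor_add_right (F : L2G₀) (G G' : L2R) :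
    tensor F (G + G') = tensor F G + tensor F G' := by
  refine Lp.ext ?_
  filter_upwards [tensor_coeFn F (G + G'), tensor_coeFn F G, tensor_coeFn F G',
    Lp.coeFn_add (tensor F G) (tensor F G'), quasi_modulus.ae (Lp.coeFn_add G G')]
    with x h1 h2 h3 h4 h5
  rw [h1, h4, Pi.add_apply, h2, h3]
  simp only [tensorFun, h5, Pi.add_apply]
  ring

theorem tensor_smul_right (c : ℂ) (F : L2G₀) (G : L2R) : tensor F (c • G) = c • tensor F G := by
  refine Lp.ext ?_
  filter_upwards [tensor_coeFn F (c • G), tensor_coeFn F G,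
    Lp.coeFn_smul c (tensor F G), quasi_modulus.ae (Lp.coeFn_smul c G)] with x h1 h2 h3 h4
  rw [h1, h3, Pi.smul_apply, h2]
  simp only [tensorFun, h4, Pi.smul_apply, smul_eq_mul]
  ring

/-- The tensor product as a continuous bilinear map. -/
def tensorL : L2G₀ →L[ℂ] L2R →L[ℂ] L2H :=
  LinearMap.mkContinuous₂
    (LinearMap.mk₂ ℂ tensor tensor_add_left tensor_smul_left tensor_add_right tensor_smul_right) 1
    fun F G => by simp [norm_tensor]

@[simp]
theorem tensorL_apply (F : L2G₀) (G : L2R) : tensorL F G = tensor F G := rfl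

theorem duu_Ioo_ne_top {a b : ℝ} (ha : 0 < a) : duu (Set.Ioo a b) ≠ ∞ := by
  rw [duu, withDensity_apply _ measurableSet_Ioo, Measure.restrict_restrict measurableSet_Ioo]
  refine ne_of_lt (lt_of_le_of_lt (setLIntegral_mono' (g := fun _ => ENNReal.ofReal a⁻¹)
    (measurableSet_Ioo.inter measurableSet_Ioi) fun u hu => ?_) ?_)
  · exact ENNReal.ofReal_le_ofReal (inv_anti₀ ha hu.1.1.le)
  · rw [setLIntegral_const]
    refine ENNReal.mul_lt_top ENNReal.ofReal_lt_top (lt_of_le_of_lt (measure_mono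
      Set.inter_subset_left) ?_)
    simp

/-- A vector of `L²(ℍ, dx)` which is orthogonal to all tensors vanishes. -/
theorem eq_zero_of_inner_tensor (φ : L2H) (h : ∀ F G, inner ℂ (tensor F G) φ = 0) : φ = 0 := by
  -- Orthogonality to the tensor of two indicators says that the integral of `f` over a polar
  -- rectangle vanishes.
  set f : ℍ[ℝ] → ℂ := fun x => ((Real.sqrt (2 * Real.pi ^ 2 * modulus x) : ℝ) : ℂ)⁻¹ * φ x with hf
  have hind : ∀ (s : Set G₀) (t : Set ℝ) (hs : MeasurableSet s) (ht : MeasurableSet t)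
      (htop : duu t ≠ ∞), (fun x => inner ℂ (tensor (indicatorConstLp 2 hs (measure_ne_top _ _) 1)
        (indicatorConstLp 2 ht htop 1) x) (φ x)) =ᵐ[dx] (polar ⁻¹' (s ×ˢ t)).indicator f := by
    intro s t hs ht htop
    filter_upwards [tensor_coeFn (indicatorConstLp 2 hs (measure_ne_top _ _) 1)
      (indicatorConstLp 2 ht htop 1), quasi_direction.ae (indicatorConstLp_coeFn (p := 2) (hs := hs)
      (hμs := measure_ne_top haarG₀ s) (c := (1 : ℂ))), quasi_modulus.ae (indicatorConstLp_coeFn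
      (p := 2) (hs := ht) (hμs := htop) (c := (1 : ℂ)))] with x h1 h2 h3
    rw [h1, tensorFun, h2, h3]
    by_cases h1 : direction x ∈ s <;> by_cases h2 : modulus x ∈ t <;>
      simp [polar, Set.indicator, h1, h2, hf, mul_comm]
  have hrect : ∀ (s : Set G₀) (t : Set ℝ), MeasurableSet s → MeasurableSet t → duu t ≠ ∞ →
      ∫ x in polar ⁻¹' (s ×ˢ t), f x ∂dx = 0 := by
    intro s t hs ht htop
    rw [← h (indicatorConstLp 2 hs (measure_ne_top _ _) 1) (indicatorConstLp 2 ht htop 1),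
      L2.inner_def, ← integral_indicator (measurable_polar (hs.prod ht))]
    exact integral_congr_ae (hind s t hs ht htop).symm
  -- These intervals exhaust `(0, ∞)` and have finite measure for `du/u`; `f` is integrable over the
  -- corresponding shells.
  set I : ℕ → Set ℝ := fun n => Set.Ioo (1 / ((n : ℝ) + 1)) (n + 1) with hI
  have hIm : ∀ n, MeasurableSet (I n) := fun n => measurableSet_Ioo
  have hItop : ∀ n, duu (I n) ≠ ∞ := fun n => duu_Ioo_ne_top (by positivity)
  have hKm : ∀ n, MeasurableSet (modulus ⁻¹' I n) := fun n => measurable_modulus (hIm n)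
  have hKint : ∀ n, IntegrableOn f (modulus ⁻¹' I n) dx := by
    intro n
    have h1 := (L2.integrable_inner (𝕜 := ℂ) (tensor (indicatorConstLp 2 MeasurableSet.univ
      (measure_ne_top _ _) 1) (indicatorConstLp 2 (hIm n) (hItop n) 1)) φ).congr
      (hind Set.univ (I n) MeasurableSet.univ (hIm n) (hItop n))
    have h2 : polar ⁻¹' (Set.univ ×ˢ I n) = modulus ⁻¹' I n := by
      ext x; simp [polar]
    rw [h2] at h1
    exact (integrable_indicator_iff (hKm n)).1 h1
  have hprod : ∀ n (S : Set (G₀ × ℝ)), MeasurableSet S →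
      ∫ x in polar ⁻¹' S, f x ∂(dx.restrict (modulus ⁻¹' I n)) = 0 := by
    intro n
    have huniv : ∫ x, f x ∂(dx.restrict (modulus ⁻¹' I n)) = 0 := by
      have h2 : polar ⁻¹' (Set.univ ×ˢ I n) = modulus ⁻¹' I n := by
        ext x; simp [polar]
      rw [← h2]
      exact hrect _ _ MeasurableSet.univ (hIm n) (hItop n)
    -- Dynkin's π-λ argument passes from rectangles to all measurable subsets of `G₀ × ℝ`.
    refine MeasurableSpace.induction_on_inter generateFrom_prod.symm isPiSystem_prod ?_ ?_ ?_ ?_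
    · simp
    · rintro _ ⟨s, hs, t, ht, rfl⟩
      have hs : MeasurableSet s := hs
      have ht : MeasurableSet t := ht
      rw [Measure.restrict_restrict (measurable_polar (hs.prod ht))]
      have h2 : polar ⁻¹' (s ×ˢ t) ∩ modulus ⁻¹' I n = polar ⁻¹' (s ×ˢ (t ∩ I n)) := by
        ext x; simp [polar, and_assoc]
      rw [h2]
      exact hrect _ _ hs (ht.inter (hIm n))
        (measure_ne_top_of_subset Set.inter_subset_right (hItop n))
    · intro S hS hS0
      rw [Set.preimage_compl, setIntegral_compl (measurable_polar hS) (hKint n), hS0, huniv, sub_zero]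
    · intro S hd hS hS0
      rw [Set.preimage_iUnion, integral_iUnion (fun i => measurable_polar (hS i))
        (fun i j hij => (hd hij).preimage _) (hKint n).integrableOn]
      simp [hS0]
  have hzero : ∀ n, ∀ᵐ x ∂(dx.restrict (modulus ⁻¹' I n)), f x = 0 := by
    intro n
    refine Integrable.ae_eq_zero_of_forall_setIntegral_eq_zero (hKint n) fun T hT _ => ?_
    -- The map `(s, u) ↦ u^{1/4} s` is a measurable left inverse of `polar`, so every measurable
    -- subset of `ℍ` is a preimage under `polar`.
    have hmeas : Measurable fun z : G₀ × ℝ => (z.2 ^ (1 / 4 : ℝ)) • (z.1 : ℍ[ℝ]) := by fun_prop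
    have hTe : T = polar ⁻¹' ((fun z : G₀ × ℝ => (z.2 ^ (1 / 4 : ℝ)) • (z.1 : ℍ[ℝ])) ⁻¹' T) := by
      ext x
      have : modulus x ^ (1 / 4 : ℝ) = ‖x‖ := by
        rw [modulus_eq, ← Real.rpow_natCast, ← Real.rpow_mul (norm_nonneg _)]
        norm_num
      simp only [polar, Set.mem_preimage, this, norm_smul_direction]
    rw [hTe]
    exact hprod n _ (hmeas hT)
  have hall : ∀ᵐ x ∂dx, ∀ n, modulus x ∈ I n → f x = 0 :=
    ae_all_iff.2 fun n => (ae_restrict_iff' (hKm n)).1 (hzero n)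
  refine Lp.ext ?_
  filter_upwards [hall, ae_ne_zero, Lp.coeFn_zero ℂ 2 dx] with x hx hx0 h0
  rw [h0, Pi.zero_apply]
  have hm := modulus_pos hx0
  obtain ⟨n, hn⟩ := exists_nat_gt (max (modulus x) (modulus x)⁻¹)
  have h1 : modulus x < n + 1 := ((le_max_left _ _).trans_lt hn).trans (by linarith)
  have h2 : 1 / ((n : ℝ) + 1) < modulus x := by
    rw [one_div]
    exact inv_lt_of_inv_lt₀ hm (((le_max_right _ _).trans_lt hn).trans (by linarith))
  have h3 := hx n ⟨h2, h1⟩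
  simp only [hf, mul_eq_zero, inv_eq_zero, Complex.ofReal_eq_zero] at h3
  refine h3.resolve_left (Real.sqrt_pos.2 (by positivity)).ne'

/-! ### The group actions on tensors -/

open scoped Pointwise in
theorem image_mul_left (g : G₀) (s : Set G₀) :
    mulLeftIso g ⁻¹' (Set.Ioo (0 : ℝ) 1 • ((↑) '' s : Set ℍ[ℝ])) =
      Set.Ioo (0 : ℝ) 1 • ((↑) '' ((fun x => g * x) ⁻¹' s) : Set ℍ[ℝ]) := by
  ext x
  simp only [Set.mem_preimage, Set.mem_smul, Set.mem_image]
  constructor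
  · rintro ⟨r, hr, _, ⟨y, hy, rfl⟩, h⟩
    refine ⟨r, hr, _, ⟨g⁻¹ * y, by simpa using hy, rfl⟩, ?_⟩
    apply (mulLeftIso g).injective
    rw [map_smul, ← h]
    congr 1
    change (g : ℍ[ℝ]) * ((g⁻¹ * y : G₀) : ℍ[ℝ]) = y
    rw [← Metric.unitSphere.coe_mul, mul_inv_cancel_left]
  · rintro ⟨r, hr, _, ⟨y, hy, rfl⟩, rfl⟩
    refine ⟨r, hr, _, ⟨g * y, hy, rfl⟩, ?_⟩
    rw [map_smul]
    rfl

/-- The spherical measure of a set is defined by the volume of the cone over it, and left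
multiplication by `g` is a linear isometry which respects cones. -/
theorem measurePreserving_mul_left (g : G₀) :
    MeasurePreserving (fun x : G₀ => g * x) haarG₀ haarG₀ := by
  have hm : Measurable (fun x : G₀ => g * x) := (continuous_const_mul g).measurable
  have h : MeasurePreserving (fun x : G₀ => g * x) (volume : Measure ℍ[ℝ]).toSphere
      (volume : Measure ℍ[ℝ]).toSphere := by
    refine ⟨hm, ?_⟩
    ext s hs
    rw [Measure.map_apply hm hs, Measure.toSphere_apply' _ hs, Measure.toSphere_apply' _ (hm hs),
      ← image_mul_left, (mulLeftIso g).measurePreserving.measure_preimage_emb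
        (mulLeftIso g).toHomeomorph.measurableEmbedding]
  exact h.smul_measure _

/-- The unitary operator `F(x) ↦ F(gx)` on `L²(G₀, d*g₀)`. -/
def leftTranslation (g : G₀) : L2G₀ →ₗᵢ[ℂ] L2G₀ :=
  Lp.compMeasurePreservingₗᵢ ℂ (fun x => g * x) (measurePreserving_mul_left g)

theorem rightTranslation_coeFn (g : G₀) (F : L2G₀) :
    rightTranslation g F =ᵐ[haarG₀] fun x => F (x * g) :=
  Lp.coeFn_compMeasurePreserving F (measurePreserving_mul_right g)

theorem leftTranslation_coeFn (g : G₀) (F : L2G₀) :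
    leftTranslation g F =ᵐ[haarG₀] fun x => F (g * x) :=
  Lp.coeFn_compMeasurePreserving F (measurePreserving_mul_left g)

/-! ### The logarithmic coordinate and dilations of the half-line. -/

theorem lintegral_duu (f : ℝ → ℝ≥0∞) (hf : Measurable f) :
    ∫⁻ u, f u ∂duu = ∫⁻ t, f (Real.exp t) := by
  have h1 : Measurable fun u : ℝ => ENNReal.ofReal u⁻¹ := by fun_prop
  have h := lintegral_image_eq_lintegral_abs_deriv_mul MeasurableSet.univ
    (fun t _ => (Real.hasDerivAt_exp t).hasDerivWithinAt) Real.exp_injective.injOn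
    (fun u => ENNReal.ofReal u⁻¹ * f u)
  rw [Set.image_univ, Real.range_exp, Measure.restrict_univ] at h
  rw [duu, lintegral_withDensity_eq_lintegral_mul _ h1 hf]
  refine h.trans (lintegral_congr fun t => ?_)
  rw [← mul_assoc, ← ENNReal.ofReal_mul (abs_nonneg _), abs_of_pos (Real.exp_pos t),
    mul_inv_cancel₀ (Real.exp_pos t).ne', ENNReal.ofReal_one, one_mul]

theorem measurePreserving_exp : MeasurePreserving Real.exp volume duu := by
  refine ⟨Real.measurable_exp, ?_⟩
  ext s hs
  rw [Measure.map_apply Real.measurable_exp hs, ← lintegral_indicator_one hs,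
    lintegral_duu _ (measurable_one.indicator hs),
    ← lintegral_indicator_one (Real.measurable_exp hs)]
  rfl

theorem measurePreserving_log : MeasurePreserving Real.log duu volume := by
  refine ⟨Real.measurable_log, ?_⟩
  rw [← measurePreserving_exp.map_eq, Measure.map_map Real.measurable_log Real.measurable_exp]
  have : Real.log ∘ Real.exp = id := funext Real.log_exp
  rw [this, Measure.map_id]

theorem ae_duu_pos : ∀ᵐ u ∂duu, 0 < u := by
  rw [← measurePreserving_exp.map_eq, ae_map_iff Real.measurable_exp.aemeasurable measurableSet_Ioi]
  exact Eventually.of_forall Real.exp_pos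

theorem measurePreserving_dilation (s : ℝ) :
    MeasurePreserving (fun u => Real.exp s * u) duu duu := by
  refine ⟨by fun_prop, ?_⟩
  rw [← measurePreserving_exp.map_eq, Measure.map_map (by fun_prop) Real.measurable_exp]
  have h1 : (fun u => Real.exp s * u) ∘ Real.exp = Real.exp ∘ fun t => s + t := by
    ext t; simp [Real.exp_add]
  rw [h1, ← Measure.map_map Real.measurable_exp (by fun_prop),
    (measurePreserving_add_left volume s).map_eq]

/-- The unitary operator `G(u) ↦ G(e^s u)` on `L²((0, ∞), du/u)`. -/
def dilation (s : ℝ) : L2R →ₗᵢ[ℂ] L2R :=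
  Lp.compMeasurePreservingₗᵢ ℂ (fun u => Real.exp s * u) (measurePreserving_dilation s)

theorem dilation_coeFn (s : ℝ) (G : L2R) :
    dilation s G =ᵐ[duu] fun u => G (Real.exp s * u) :=
  Lp.coeFn_compMeasurePreserving G (measurePreserving_dilation s)

theorem quasi_mul_right (g : ℍ[ℝ]ˣ) :
    Measure.QuasiMeasurePreserving (fun x => x * (g : ℍ[ℝ])) dx dx :=
  quasi_of_map (continuous_mul_const (g : ℍ[ℝ])).measurable (map_mul_right g)

theorem quasi_mul_left (g : ℍ[ℝ]ˣ) :
    Measure.QuasiMeasurePreserving (fun x => (g : ℍ[ℝ]) * x) dx dx :=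
  quasi_of_map (continuous_const_mul (g : ℍ[ℝ])).measurable (map_mul_left g)

theorem modulus_mul (x y : ℍ[ℝ]) : modulus (x * y) = modulus x * modulus y := by
  simp [modulus, mul_pow]

theorem modulus_coe (g : G₀) : modulus (g : ℍ[ℝ]) = 1 := by
  simp [modulus_eq]

theorem direction_mul_right {x : ℍ[ℝ]} (hx : x ≠ 0) (g : G₀) :
    direction (x * g) = direction x * g := by
  have := norm_ne_zero_iff.2 hx
  apply Subtype.ext
  simp [direction, hx]

theorem direction_mul_left {x : ℍ[ℝ]} (hx : x ≠ 0) (g : G₀) :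
    direction (g * x) = g * direction x := by
  have := norm_ne_zero_iff.2 hx
  apply Subtype.ext
  simp [direction, hx]

theorem L₁_unit_tensor (g : G₀) (F : L2G₀) (G : L2R) :
    L₁ (unitSphereToUnits ℍ[ℝ] g) (tensor F G) = tensor (rightTranslation g F) G := by
  refine Lp.ext ?_
  filter_upwards [L₁_apply (unitSphereToUnits ℍ[ℝ] g) (tensor F G),
    tensor_coeFn (rightTranslation g F) G, (quasi_mul_right _).ae (tensor_coeFn F G), ae_ne_zero,
    quasi_direction.ae (rightTranslation_coeFn g F)] with x h1 h2 h3 h4 h5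
  rw [h1, h2, h3]
  simp [tensorFun, modulus_mul, modulus_coe, direction_mul_right h4, h5]

theorem R₁_unit_tensor (g : G₀) (F : L2G₀) (G : L2R) :
    R₁ (unitSphereToUnits ℍ[ℝ] g) (tensor F G) = tensor (leftTranslation g F) G := by
  refine Lp.ext ?_
  filter_upwards [R₁_apply (unitSphereToUnits ℍ[ℝ] g) (tensor F G),
    tensor_coeFn (leftTranslation g F) G, (quasi_mul_left _).ae (tensor_coeFn F G), ae_ne_zero,
    quasi_direction.ae (leftTranslation_coeFn g F)] with x h1 h2 h3 h4 h5
  rw [h1, h2, h3]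
  simp [tensorFun, modulus_mul, modulus_coe, direction_mul_left h4, h5]

/-- The central unit `e^{s/4}`, of module `e^s`. -/
def expUnit (s : ℝ) : ℍ[ℝ]ˣ :=
  Units.mk0 ((Real.exp (s / 4) : ℝ) : ℍ[ℝ]) fun h =>
    (Real.exp_pos (s / 4)).ne' (by simpa using congrArg QuaternionAlgebra.re h)

theorem modulus_expUnit (s : ℝ) : modulus (expUnit s : ℍ[ℝ]) = Real.exp s := by
  simp only [expUnit, Units.val_mk0, modulus, Quaternion.normSq_coe]
  rw [← Real.exp_nat_mul, ← Real.exp_nat_mul]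
  congr 1
  push_cast
  ring

theorem direction_mul_expUnit (x : ℍ[ℝ]) (s : ℝ) :
    direction (x * (expUnit s : ℍ[ℝ])) = direction x := by
  apply Subtype.ext
  have he := Real.exp_pos (s / 4)
  have h1 : x * (expUnit s : ℍ[ℝ]) = Real.exp (s / 4) • x := by
    simp [expUnit, ← Quaternion.coe_commutes, Quaternion.coe_mul_eq_smul]
  simp only [direction, h1, norm_smul, Real.norm_of_nonneg he.le, mul_eq_zero, he.ne', false_or]
  split_ifs with h
  · rfl
  · rw [smul_smul]
    congr 1
    field_simp

/-- The factor `|g|^{1/2}` of `L₁` cancels the change of `|x|^{-1/2}`, so only the argument of `G`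
is dilated. -/
theorem L₁_expUnit_tensor (s : ℝ) (F : L2G₀) (G : L2R) :
    L₁ (expUnit s) (tensor F G) = tensor F (dilation s G) := by
  refine Lp.ext ?_
  filter_upwards [L₁_apply (expUnit s) (tensor F G),
    tensor_coeFn F (dilation s G), (quasi_mul_right _).ae (tensor_coeFn F G),
    quasi_modulus.ae (dilation_coeFn s G)] with x h1 h2 h3 h4
  rw [h1, h2, h3]
  have hs : ((Real.sqrt (Real.exp s) : ℝ) : ℂ) ≠ 0 := by
    rw [Complex.ofReal_ne_zero]
    exact (Real.sqrt_pos.2 (Real.exp_pos s)).ne'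
  have hm : 2 * Real.pi ^ 2 * (modulus x * Real.exp s) =
      (Real.exp s) * (2 * Real.pi ^ 2 * modulus x) := by ring
  simp only [tensorFun, modulus_mul, modulus_expUnit, direction_mul_expUnit, h4, hm]
  rw [Real.sqrt_mul (Real.exp_pos s).le, mul_comm (modulus x)]
  push_cast
  field_simp

/-! ### Matrix coefficients -/

section forms

variable {R : Type*} [CommRing R]

/-- The linear form `c a - b'` in an indeterminate `c`. -/
def formP (a b' : R) : Polynomial R := .C a * .X - .C b'

/-- The linear form `c b + a'` in an indeterminate `c`. -/
def formQ (b a' : R) : Polynomial R := .C b * .X + .C a'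

/-- The forms `P = ca - b'` and `Q = cb + a'` have derivatives `a` and `b` in `c`, so this is the
Wronskian identity `P'Q - PQ' = 1`, equivalent to the determinant relation `h`. -/
theorem formQ_mul_sub {a b a' b' : R} (h : a * a' + b * b' = 1) :
    .C a * formQ b a' - .C b * formP a b' = 1 := by
  have h' := congrArg (Polynomial.C : R →+* _) h
  rw [map_add, map_mul, map_mul, map_one] at h'
  rw [← h', formP, formQ]
  ring

theorem derivative_formP (a b' : R) : Polynomial.derivative (formP a b') = .C a := by
  simp [formP]

theorem derivative_formQ (b a' : R) : Polynomial.derivative (formQ b a') = .C b := by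
  simp [formQ]

/-- By Leibniz `(P^{k+1} Q^l)' = (k+1) a P^k Q^l + l b P^{k+1} Q^{l-1}`, and the Wronskian identity
replaces `b P` by `a Q - 1`. For `l = 0` the truncated exponent `l - 1` is harmless because of the
factor `l`. The point is that multiplication by `a` is expressed through products of the same shape.
-/
theorem C_mul_forms_left {a b a' b' : R} (h : a * a' + b * b' = 1) (k l : ℕ) :
    ((k + l + 1 : ℕ) : Polynomial R) * (.C a * (formP a b' ^ k * formQ b a' ^ l)) =
      Polynomial.derivative (formP a b' ^ (k + 1) * formQ b a' ^ l) +
        l * (formP a b' ^ k * formQ b a' ^ (l - 1)) := by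
  have h := formQ_mul_sub h
  rcases l with _ | l
  · simp [Polynomial.derivative_pow, derivative_formP]
    ring
  · simp only [Polynomial.derivative_mul, Polynomial.derivative_pow, derivative_formP,
      derivative_formQ, Nat.cast_add, Nat.cast_one, Nat.add_sub_cancel, map_add, map_natCast, map_one]
    linear_combination (((l : Polynomial R) + 1) * formP a b' ^ k * formQ b a' ^ l) * h

theorem C_mul_forms_right {a b a' b' : R} (h : a * a' + b * b' = 1) (k l : ℕ) :
    ((k + l + 1 : ℕ) : Polynomial R) * (.C b * (formP a b' ^ k * formQ b a' ^ l)) =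
      Polynomial.derivative (formP a b' ^ k * formQ b a' ^ (l + 1)) -
        k * (formP a b' ^ (k - 1) * formQ b a' ^ l) := by
  have h := formQ_mul_sub h
  rcases k with _ | k
  · simp [Polynomial.derivative_pow, derivative_formQ]
    ring
  · simp only [Polynomial.derivative_mul, Polynomial.derivative_pow, derivative_formP,
      derivative_formQ, Nat.cast_add, Nat.cast_one, Nat.add_sub_cancel, map_add, map_natCast, map_one]
    linear_combination (-((k : Polynomial R) + 1) * formP a b' ^ k * formQ b a' ^ l) * h

variable [Algebra ℂ R]

/-- The evaluation of a polynomial in two variables at `(c a - b', c b + a')`. -/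
def evalForms (a b a' b' : R) : MvPolynomial (Fin 2) ℂ →ₐ[ℂ] Polynomial R :=
  MvPolynomial.aeval ![formP a b', formQ b a']

@[simp]
theorem evalForms_X_zero (a b a' b' : R) :
    evalForms a b a' b' (MvPolynomial.X 0) = formP a b' := by
  simp [evalForms]

@[simp]
theorem evalForms_X_one (a b a' b' : R) :
    evalForms a b a' b' (MvPolynomial.X 1) = formQ b a' := by
  simp [evalForms]

theorem evalForms_C (a b a' b' : R) (c : ℂ) :
    evalForms a b a' b' (MvPolynomial.C c) = Polynomial.C (algebraMap ℂ R c) :=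
  ((evalForms a b a' b').commutes c).trans (Polynomial.algebraMap_apply c)

theorem substitution_X_zero (g : ℍ[ℝ]) : substitution g (MvPolynomial.X 0) =
    MvPolynomial.C (⟨g.re, g.imI⟩ : ℂ) * MvPolynomial.X 0
        - MvPolynomial.C (conj (⟨g.imJ, g.imK⟩ : ℂ)) * MvPolynomial.X 1 := by
  simp [substitution]

theorem substitution_X_one (g : ℍ[ℝ]) : substitution g (MvPolynomial.X 1) =
    MvPolynomial.C (⟨g.imJ, g.imK⟩ : ℂ) * MvPolynomial.X 0
        + MvPolynomial.C (conj (⟨g.re, g.imI⟩ : ℂ)) * MvPolynomial.X 1 := by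
  simp [substitution]

/-- The hypotheses on `φ` are the rules for right translation of `A`, `B` and their conjugates. The
indeterminate `c` is untouched by `φ`, so taking the coefficient of any fixed power of `c` gives an
equivariant map on `V_N`. An identity of algebra homomorphisms need only be checked on the two
variables. -/
theorem evalForms_substitution {a b a' b' : R} (g : ℍ[ℝ]) {α β : ℂ} (hα : α = ⟨g.re, g.imI⟩)
    (hβ : β = ⟨g.imJ, g.imK⟩) (φ : R →ₐ[ℂ] R)
    (ha : φ a = algebraMap ℂ R α * a - algebraMap ℂ R (conj β) * b)
    (hb : φ b = algebraMap ℂ R β * a + algebraMap ℂ R (conj α) * b)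
    (ha' : φ a' = algebraMap ℂ R (conj α) * a' - algebraMap ℂ R β * b')
    (hb' : φ b' = algebraMap ℂ R (conj β) * a' + algebraMap ℂ R α * b')
    (v : MvPolynomial (Fin 2) ℂ) :
    evalForms a b a' b' (substitution g v) = Polynomial.mapAlgHom φ (evalForms a b a' b' v) := by
  suffices h : (evalForms a b a' b').comp (substitution g) =
      (Polynomial.mapAlgHom φ).comp (evalForms a b a' b') from DFunLike.congr_fun h v
  refine MvPolynomial.algHom_ext fun i => ?_
  fin_cases i
  · change evalForms a b a' b' (substitution g (MvPolynomial.X 0)) =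
      Polynomial.mapAlgHom φ (evalForms a b a' b' (MvPolynomial.X 0))
    rw [substitution_X_zero, ← hα, ← hβ]
    simp only [map_sub, map_mul, evalForms_C, evalForms_X_zero, evalForms_X_one]
    simp only [formP, formQ, Polynomial.coe_mapAlgHom, Polynomial.map_C, Polynomial.map_X,
      RingHom.coe_coe, ha, hb', map_sub, map_mul, map_add]
    ring
  · change evalForms a b a' b' (substitution g (MvPolynomial.X 1)) =
      Polynomial.mapAlgHom φ (evalForms a b a' b' (MvPolynomial.X 1))
    rw [substitution_X_one, ← hα, ← hβ]
    simp only [map_add, map_mul, evalForms_C, evalForms_X_zero, evalForms_X_one]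
    simp only [formP, formQ, Polynomial.coe_mapAlgHom, Polynomial.map_C, Polynomial.map_X,
      RingHom.coe_coe, hb, ha', map_sub, map_mul, map_add]
    ring

/-- The coefficient of `c^i` in `(c a - b')^k (c b + a')^l`. -/
def formCoeff (a b a' b' : R) (i k l : ℕ) : R := (formP a b' ^ k * formQ b a' ^ l).coeff i

/-- The span of all coefficients of the products `(c a - b')^k (c b + a')^l`. -/
def formSpan (a b a' b' : R) : Submodule ℂ R :=
  Submodule.span ℂ (Set.range fun z : ℕ × ℕ × ℕ => formCoeff a b a' b' z.1 z.2.1 z.2.2)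

variable {a b a' b' : R}

theorem formCoeff_mem (i k l : ℕ) : formCoeff a b a' b' i k l ∈ formSpan a b a' b' :=
  Submodule.subset_span ⟨(i, k, l), rfl⟩

theorem natCast_mul_mem (U : Submodule ℂ R) {n : ℕ} (hn : n ≠ 0) {f : R} (h : (n : R) * f ∈ U) :
    f ∈ U := by
  have hn' : (n : ℂ) ≠ 0 := Nat.cast_ne_zero.2 hn
  have h1 : f = (n : ℂ)⁻¹ • ((n : R) * f) := by
    rw [← nsmul_eq_mul, ← Nat.cast_smul_eq_nsmul ℂ, smul_smul, inv_mul_cancel₀ hn', one_smul]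
  rw [h1]
  exact U.smul_mem _ h

theorem natCast_mul_formCoeff_mem (n i k l : ℕ) :
    (n : R) * formCoeff a b a' b' i k l ∈ formSpan a b a' b' := by
  rw [← nsmul_eq_mul]
  exact nsmul_mem (formCoeff_mem _ _ _) n

/-- Compare coefficients of `c^i` in `C_mul_forms_left`: the derivative contributes `i + 1` times a
coefficient of index `i + 1`, and the integer `k + l + 1` can be divided out over `ℂ`. -/
theorem left_mul_formCoeff_mem (h : a * a' + b * b' = 1) (i k l : ℕ) :
    a * formCoeff a b a' b' i k l ∈ formSpan a b a' b' := by
  refine natCast_mul_mem _ (Nat.succ_ne_zero (k + l)) ?_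
  have h := congrArg (Polynomial.coeff · i) (C_mul_forms_left h k l)
  simp only [← Polynomial.C_eq_natCast, Polynomial.coeff_C_mul, Polynomial.coeff_add,
    Polynomial.coeff_derivative] at h
  change ((k + l + 1 : ℕ) : R) * (a * formCoeff a b a' b' i k l) = _ at h
  rw [h]
  refine add_mem ?_ (natCast_mul_formCoeff_mem l i k (l - 1))
  have := natCast_mul_formCoeff_mem (a := a) (b := b) (a' := a') (b' := b') (i + 1) (i + 1) (k + 1) l
  rw [mul_comm] at this
  exact_mod_cast this

theorem right_mul_formCoeff_mem (h : a * a' + b * b' = 1) (i k l : ℕ) :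
    b * formCoeff a b a' b' i k l ∈ formSpan a b a' b' := by
  refine natCast_mul_mem _ (Nat.succ_ne_zero (k + l)) ?_
  have h := congrArg (Polynomial.coeff · i) (C_mul_forms_right h k l)
  simp only [← Polynomial.C_eq_natCast, Polynomial.coeff_C_mul, Polynomial.coeff_sub,
    Polynomial.coeff_derivative] at h
  change ((k + l + 1 : ℕ) : R) * (b * formCoeff a b a' b' i k l) = _ at h
  rw [h]
  refine sub_mem ?_ (natCast_mul_formCoeff_mem k i (k - 1) l)
  have := natCast_mul_formCoeff_mem (a := a) (b := b) (a' := a') (b' := b') (i + 1) (i + 1) k (l + 1)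
  rw [mul_comm] at this
  exact_mod_cast this

/-- Since `a' = Q - cb`, multiplication by `a'` reduces to raising the exponent of `Q` and to
multiplication by `b` with the index of the coefficient lowered by one. -/
theorem left'_mul_formCoeff_mem (h : a * a' + b * b' = 1) (i k l : ℕ) :
    a' * formCoeff a b a' b' i k l ∈ formSpan a b a' b' := by
  have h1 : .C a' * (formP a b' ^ k * formQ b a' ^ l) =
      formP a b' ^ k * formQ b a' ^ (l + 1) - .C b * ((formP a b' ^ k * formQ b a' ^ l) * .X) := by
    have : Polynomial.C a' = formQ b a' - .C b * .X := by simp [formQ]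
    rw [this]
    ring
  have h1 := congrArg (Polynomial.coeff · i) h1
  simp only [Polynomial.coeff_C_mul, Polynomial.coeff_sub] at h1
  change a' * formCoeff a b a' b' i k l = formCoeff a b a' b' i k (l + 1) - _ at h1
  rw [h1]
  refine sub_mem (formCoeff_mem _ _ _) ?_
  rcases i with _ | i
  · simp
  · rw [Polynomial.coeff_mul_X]
    exact right_mul_formCoeff_mem h i k l

theorem right'_mul_formCoeff_mem (h : a * a' + b * b' = 1) (i k l : ℕ) :
    b' * formCoeff a b a' b' i k l ∈ formSpan a b a' b' := by
  have h1 : .C b' * (formP a b' ^ k * formQ b a' ^ l) =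
      .C a * ((formP a b' ^ k * formQ b a' ^ l) * .X) - formP a b' ^ (k + 1) * formQ b a' ^ l := by
    have : Polynomial.C b' = .C a * .X - formP a b' := by simp [formP]
    rw [this]
    ring
  have h1 := congrArg (Polynomial.coeff · i) h1
  simp only [Polynomial.coeff_C_mul, Polynomial.coeff_sub] at h1
  change b' * formCoeff a b a' b' i k l = _ - formCoeff a b a' b' i (k + 1) l at h1
  rw [h1]
  refine sub_mem ?_ (formCoeff_mem _ _ _)
  rcases i with _ | i
  · simp
  · rw [Polynomial.coeff_mul_X]
    exact left_mul_formCoeff_mem h i k l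

theorem mul_mem_formSpan {f : R} (hf : ∀ i k l, f * formCoeff a b a' b' i k l ∈ formSpan a b a' b')
    {h : R} (hh : h ∈ formSpan a b a' b') : f * h ∈ formSpan a b a' b' := by
  induction hh using Submodule.span_induction with
  | mem x hx => obtain ⟨z, rfl⟩ := hx; exact hf _ _ _
  | zero => simp
  | add x y _ _ hx hy => rw [mul_add]; exact add_mem hx hy
  | smul c x _ hx => rw [mul_smul_comm]; exact Submodule.smul_mem _ c hx

/-- The span of the coefficients of the products `(c a - b')^k (c b + a')^l` contains the algebra
generated by `a`, `b`, `a'`, `b'`. -/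
theorem adjoin_le_formSpan (h : a * a' + b * b' = 1) {f : R}
    (hf : f ∈ Algebra.adjoin ℂ {a, b, a', b'}) : f ∈ formSpan a b a' b' := by
  have hsub : ∀ x ∈ formSpan a b a' b', f * x ∈ formSpan a b a' b' := by
    induction hf using Algebra.adjoin_induction with
    | mem x hx =>
      intro y hy
      rcases hx with rfl | rfl | rfl | rfl
      · exact mul_mem_formSpan (left_mul_formCoeff_mem h) hy
      · exact mul_mem_formSpan (right_mul_formCoeff_mem h) hy
      · exact mul_mem_formSpan (left'_mul_formCoeff_mem h) hy
      · exact mul_mem_formSpan (right'_mul_formCoeff_mem h) hy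
    | algebraMap r =>
      intro y hy
      rw [← Algebra.smul_def]
      exact Submodule.smul_mem _ r hy
    | add x y _ _ hx hy =>
      intro z hz
      rw [add_mul]
      exact add_mem (hx z hz) (hy z hz)
    | mul x y _ _ hx hy =>
      intro z hz
      rw [mul_assoc]
      exact hx _ (hy z hz)
  -- The empty product has constant coefficient 1, so an element stabilizing the span lies in it.
  have hone : (1 : R) ∈ formSpan a b a' b' := by
    have h := formCoeff_mem (a := a) (b := b) (a' := a') (b' := b') 0 0 0
    simpa [formCoeff] using h
  simpa using hsub 1 hone

end forms

/-! ### Coordinate functions on `G₀` -/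

instance : CommRing C(G₀, ℂ) := ContinuousMap.instCommRingOfIsTopologicalRing

theorem continuous_complex_mk {X : Type*} [TopologicalSpace X] {f g : X → ℝ} (hf : Continuous f)
    (hg : Continuous g) : Continuous fun x => (⟨f x, g x⟩ : ℂ) :=
  Complex.equivRealProdCLM.symm.continuous.comp (hf.prodMk hg)

/-- The coordinate function `A` on `G₀`. -/
def coordA : C(G₀, ℂ) where
  toFun x := ⟨(x : ℍ[ℝ]).re, (x : ℍ[ℝ]).imI⟩
  continuous_toFun := continuous_complex_mk (Quaternion.continuous_re.comp continuous_subtype_val)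
    (Quaternion.continuous_imI.comp continuous_subtype_val)

/-- The coordinate function `B` on `G₀`. -/
def coordB : C(G₀, ℂ) where
  toFun x := ⟨(x : ℍ[ℝ]).imJ, (x : ℍ[ℝ]).imK⟩
  continuous_toFun := continuous_complex_mk (Quaternion.continuous_imJ.comp continuous_subtype_val)
    (Quaternion.continuous_imK.comp continuous_subtype_val)

/-- The algebra endomorphism `f(x) ↦ f(xg)` of `C(G₀)`. -/
def rightComp (g : G₀) : C(G₀, ℂ) →ₐ[ℂ] C(G₀, ℂ) :=
  ContinuousMap.compRightAlgHom ℂ ℂ ⟨fun x => x * g, continuous_mul_const g⟩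

/-- The algebra endomorphism `f(x) ↦ f(gx)` of `C(G₀)`. -/
def leftComp (g : G₀) : C(G₀, ℂ) →ₐ[ℂ] C(G₀, ℂ) :=
  ContinuousMap.compRightAlgHom ℂ ℂ ⟨fun x => g * x, continuous_const_mul g⟩

@[simp]
theorem rightComp_apply (g : G₀) (f : C(G₀, ℂ)) (x : G₀) : rightComp g f x = f (x * g) := rfl

@[simp]
theorem leftComp_apply (g : G₀) (f : C(G₀, ℂ)) (x : G₀) : leftComp g f x = f (g * x) := rfl

theorem coordA_mul (x y : G₀) :
    coordA (x * y) = coordA x * coordA y - coordB x * conj (coordB y) := by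
  apply Complex.ext <;> simp [coordA, coordB] <;> ring

theorem coordB_mul (x y : G₀) :
    coordB (x * y) = coordA x * coordB y + coordB x * conj (coordA y) := by
  apply Complex.ext <;> simp [coordA, coordB] <;> ring

theorem coord_norm (x : G₀) : coordA x * conj (coordA x) + coordB x * conj (coordB x) = 1 := by
  have h : Quaternion.normSq (x : ℍ[ℝ]) = 1 := by
    rw [Quaternion.normSq_eq_norm_mul_self]; simp
  rw [Quaternion.normSq_def'] at h
  rw [Complex.mul_conj, Complex.mul_conj]
  norm_cast
  simp only [coordA, coordB, Complex.normSq_apply, ContinuousMap.coe_mk]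
  linarith

theorem mem_sphere_of_sq_add {y : ℍ[ℝ]} (h : y.re ^ 2 + y.imI ^ 2 + y.imJ ^ 2 + y.imK ^ 2 = 1) :
    y ∈ Metric.sphere (0 : ℍ[ℝ]) 1 := by
  rw [← Quaternion.normSq_def', Quaternion.normSq_eq_norm_mul_self] at h
  rw [mem_sphere_zero_iff_norm]
  nlinarith [norm_nonneg y]

/-- The unit quaternion with given coordinates. -/
def ofCoords (a b : ℂ) (h : ‖a‖ ^ 2 + ‖b‖ ^ 2 = 1) : G₀ :=
  ⟨⟨a.re, a.im, b.re, b.im⟩, mem_sphere_of_sq_add (by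
    rw [← h, ← Complex.normSq_eq_norm_sq, ← Complex.normSq_eq_norm_sq, Complex.normSq_apply,
      Complex.normSq_apply]
    ring)⟩

@[simp]
theorem coordB_ofCoords (a b : ℂ) (h : ‖a‖ ^ 2 + ‖b‖ ^ 2 = 1) : coordB (ofCoords a b h) = b := rfl

/-- Stone–Weierstrass: `A` and `B` determine a quaternion, so the star algebra they generate
separates points, and it lies in the span because `AĀ + BB̄ = 1` on `G₀`. -/
theorem dense_formSpan :
    (formSpan coordA coordB (star coordA) (star coordB)).topologicalClosure = ⊤ := by
  have hrel : coordA * star coordA + coordB * star coordB = 1 := by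
    ext x
    exact coord_norm x
  have hle : ((StarAlgebra.adjoin ℂ {coordA, coordB} : StarSubalgebra ℂ C(G₀, ℂ)) :
      Set C(G₀, ℂ)) ⊆ formSpan coordA coordB (star coordA) (star coordB) := by
    intro f hf
    rw [SetLike.mem_coe, ← StarSubalgebra.mem_toSubalgebra, StarAlgebra.adjoin_toSubalgebra] at hf
    refine adjoin_le_formSpan hrel (Algebra.adjoin_mono ?_ hf)
    rintro x ((rfl | rfl) | hx)
    · simp
    · simp
    · rcases hx with hx | hx
      · rw [← star_star x, hx]
        simp
      · rw [Set.mem_singleton_iff] at hx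
        rw [← star_star x, hx]
        simp
  have hsep : (StarAlgebra.adjoin ℂ {coordA, coordB} :
      StarSubalgebra ℂ C(G₀, ℂ)).SeparatesPoints := by
    intro x y hxy
    by_contra hcon
    push Not at hcon
    have hA := hcon coordA ⟨coordA, StarAlgebra.subset_adjoin ℂ _ (by simp), rfl⟩
    have hB := hcon coordB ⟨coordB, StarAlgebra.subset_adjoin ℂ _ (by simp), rfl⟩
    apply hxy
    simp only [coordA, coordB, ContinuousMap.coe_mk, Complex.mk.injEq] at hA hB
    apply Subtype.ext
    exact QuaternionAlgebra.ext hA.1 hA.2 hB.1 hB.2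
  have htop := ContinuousMap.starSubalgebra_topologicalClosure_eq_top_of_separatesPoints _ hsep
  rw [Submodule.eq_top_iff']
  intro f
  have hf : f ∈ (StarAlgebra.adjoin ℂ {coordA, coordB} :
      StarSubalgebra ℂ C(G₀, ℂ)).topologicalClosure := by rw [htop]; trivial
  exact closure_mono hle hf

/-! ### Polarization -/

/-- Modulo `Q` the sum is a polynomial in `t` vanishing identically. Linear functionals separate the
points of the quotient, which reduces the claim to scalar polynomials over the infinite field `ℂ`.
-/
theorem mem_of_forall_sum_pow_smul_mem {E : Type*} [AddCommGroup E] [Module ℂ E] (Q : Submodule ℂ E)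
    (N : ℕ) (v : ℕ → E) (h : ∀ t : ℂ, ∑ m ∈ Finset.range (N + 1), t ^ m • v m ∈ Q) {m : ℕ}
    (hm : m ≤ N) : v m ∈ Q := by
  rw [← Submodule.Quotient.mk_eq_zero, ← Module.forall_dual_apply_eq_zero_iff ℂ]
  intro f
  set p : Polynomial ℂ := ∑ m ∈ Finset.range (N + 1),
    Polynomial.monomial m (f (Submodule.Quotient.mk (v m))) with hp
  have hp0 : p = 0 := by
    refine Polynomial.funext fun t => ?_
    have h1 := congrArg f ((Submodule.Quotient.mk_eq_zero Q).2 (h t))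
    rw [map_zero, ← Submodule.mkQ_apply, map_sum, map_sum] at h1
    rw [hp, Polynomial.eval_finsetSum, Polynomial.eval_zero, ← h1]
    refine Finset.sum_congr rfl fun m _ => ?_
    simp [mul_comm]
  have h2 := congrArg (Polynomial.coeff · m) hp0
  simpa [hp, Polynomial.finsetSum_coeff, Polynomial.coeff_monomial, Nat.lt_succ_of_le hm] using h2

theorem mem_of_forall_unit_sum_mem {E : Type*} [AddCommGroup E] [Module ℂ E] (Q : Submodule ℂ E)
    (N : ℕ) (v : ℕ → E) (h : ∀ a b : ℂ, ‖a‖ ^ 2 + ‖b‖ ^ 2 = 1 →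
      ∑ m ∈ Finset.range (N + 1), (a ^ m * b ^ (N - m)) • v m ∈ Q) {m : ℕ}
    (hm : m ≤ N) : v m ∈ Q := by
  refine mem_of_forall_sum_pow_smul_mem Q N v (fun t => ?_) hm
  set r : ℝ := Real.sqrt (1 + ‖t‖ ^ 2) with hr
  have hpos : 0 < 1 + ‖t‖ ^ 2 := by positivity
  have hr0 : 0 < r := Real.sqrt_pos.2 hpos
  have hr2 : r ^ 2 = 1 + ‖t‖ ^ 2 := Real.sq_sqrt hpos.le
  have hrc : (r : ℂ) ≠ 0 := Complex.ofReal_ne_zero.2 hr0.ne'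
  -- The pair `(t, 1)` is normalized to length one; homogeneity of degree `N` lets the factor `r^N`
  -- undo this.
  have h1 := h (t / r) (1 / r) (by
    rw [norm_div, norm_div, Complex.norm_real, Real.norm_of_nonneg hr0.le, norm_one]
    field_simp
    linarith)
  have h2 := Q.smul_mem ((r : ℂ) ^ N) h1
  rw [Finset.smul_sum] at h2
  convert h2 using 1
  refine Finset.sum_congr rfl fun m hm => ?_
  have hm : m ≤ N := Nat.lt_succ_iff.1 (Finset.mem_range.1 hm)
  rw [smul_smul]
  congr 1
  have : (r : ℂ) ^ N = (r : ℂ) ^ m * (r : ℂ) ^ (N - m) := by rw [← pow_add, Nat.add_sub_cancel' hm]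
  rw [this, div_pow, div_pow, one_pow]
  field_simp

/-! ### The representations `V_N` -/

/-- The monomial `A^k B^l`. -/
def mono {N : ℕ} (k l : ℕ) (h : k + l = N) : V N :=
  ⟨MvPolynomial.X 0 ^ k * MvPolynomial.X 1 ^ l, by
    rw [MvPolynomial.mem_homogeneousSubmodule, ← h]
    simpa using ((MvPolynomial.isHomogeneous_X ℂ 0).pow k).mul
      ((MvPolynomial.isHomogeneous_X ℂ 1).pow l)⟩

theorem eq_top_of_mono_mem {N : ℕ} (Q : Submodule ℂ (V N))
    (h : ∀ (k l : ℕ) (hkl : k + l = N), mono k l hkl ∈ Q) : Q = ⊤ := by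
  rw [Submodule.eq_top_iff']
  intro v
  have hv := (MvPolynomial.mem_homogeneousSubmodule N v.1).1 v.2
  suffices h1 : v.1 ∈ Q.map (V N).subtype by
    obtain ⟨w, hw, hwv⟩ := h1
    rwa [← Subtype.ext hwv]
  rw [MvPolynomial.as_sum v.1]
  refine Submodule.sum_mem _ fun d hd => ?_
  have hdeg := hv (MvPolynomial.mem_support_iff.1 hd)
  have hsum : d 0 + d 1 = N := by
    rw [← hdeg]
    simp [Finsupp.weight_apply, Finsupp.sum_fintype]
  have h2 : MvPolynomial.monomial d (MvPolynomial.coeff d v.1) =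
      MvPolynomial.coeff d v.1 • (mono (d 0) (d 1) hsum : MvPolynomial (Fin 2) ℂ) := by
    rw [MvPolynomial.monomial_eq, Finsupp.prod_fintype _ _ (by simp), MvPolynomial.smul_eq_C_mul]
    simp [mono]
  rw [h2]
  exact Submodule.smul_mem _ _ ⟨_, h _ _ hsum, rfl⟩

theorem coe_actV (N : ℕ) (g : ℍ[ℝ]) (v : V N) :
    (actV N g v : MvPolynomial (Fin 2) ℂ) = substitution g v := rfl

/-- A subspace of `V_N` which contains all translates of the highest weight vector is everything. -/
theorem eq_top_of_actV_mem {N : ℕ} (Q : Submodule ℂ (V N))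
    (h : ∀ g : G₀, actV N g (mono N 0 (add_zero N)) ∈ Q) : Q = ⊤ := by
  -- `v m` is the coefficient of `a^m b^{N-m}` in `(aA + bB)^N`.
  set v : ℕ → V N := fun m => if hm : m ≤ N then
    (N.choose m : ℂ) • mono m (N - m) (Nat.add_sub_cancel' hm) else 0 with hv
  have hQ : ∀ m ≤ N, v m ∈ Q := by
    intro m hm
    refine mem_of_forall_unit_sum_mem Q N v (fun a b hab => ?_) hm
    -- This unit quaternion sends `A` to `aA + bB`, hence the highest weight vector `A^N` to `(aA +
    -- bB)^N`.
    have h1 := h (ofCoords a (-conj b) (by simpa using hab))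
    convert h1 using 1
    apply Subtype.ext
    rw [coe_actV]
    simp only [mono, pow_zero, mul_one, map_pow]
    refine Eq.trans ?_ (congrArg (· ^ N) (substitution_X_zero _)).symm
    change _ = (MvPolynomial.C a * MvPolynomial.X 0 - MvPolynomial.C (conj (-conj b)) *
      MvPolynomial.X 1) ^ N
    rw [map_neg, Complex.conj_conj, map_neg, neg_mul, sub_neg_eq_add, add_pow,
      AddSubmonoidClass.coe_finsetSum]
    refine Finset.sum_congr rfl fun m hm => ?_
    have hm : m ≤ N := Nat.lt_succ_iff.1 (Finset.mem_range.1 hm)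
    simp only [hv, hm, dif_pos, mono, SetLike.val_smul, MvPolynomial.smul_eq_C_mul, mul_pow,
      map_mul, map_pow, map_natCast]
    ring
  refine eq_top_of_mono_mem Q fun k l hkl => ?_
  have hk : k ≤ N := by omega
  have h1 := hQ k hk
  have hc : (N.choose k : ℂ) ≠ 0 := Nat.cast_ne_zero.2 (Nat.choose_pos hk).ne'
  simp only [hv, hk, dif_pos] at h1
  have h2 := (Submodule.smul_mem_iff Q hc).1 h1
  have hl : N - k = l := by omega
  subst hl
  exact h2

/-! ### Isotypical components of `L²(G₀)` -/

/-- The inclusion of `C(G₀)` into `L²(G₀)`. -/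
def toL2 : C(G₀, ℂ) →L[ℂ] L2G₀ := ContinuousMap.toLp 2 haarG₀ ℂ

theorem toL2_coeFn (f : C(G₀, ℂ)) : toL2 f =ᵐ[haarG₀] f :=
  ContinuousMap.coeFn_toLp haarG₀ f

theorem rightTranslation_toL2 (g : G₀) (f : C(G₀, ℂ)) :
    rightTranslation g (toL2 f) = toL2 (rightComp g f) := by
  refine Lp.ext ?_
  filter_upwards [rightTranslation_coeFn g (toL2 f), toL2_coeFn (rightComp g f),
    (measurePreserving_mul_right g).quasiMeasurePreserving.ae (toL2_coeFn f)] with x h1 h2 h3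
  rw [h1, h2, h3, rightComp_apply]

theorem leftTranslation_toL2 (g : G₀) (f : C(G₀, ℂ)) :
    leftTranslation g (toL2 f) = toL2 (leftComp g f) := by
  refine Lp.ext ?_
  filter_upwards [leftTranslation_coeFn g (toL2 f), toL2_coeFn (leftComp g f),
    (measurePreserving_mul_left g).quasiMeasurePreserving.ae (toL2_coeFn f)] with x h1 h2 h3
  rw [h1, h2, h3, leftComp_apply]

/-- The matrix coefficient with indices `i` and `k`, `l` in `L²(G₀)`. -/
def matrixCoeff (i k l : ℕ) : L2G₀ :=
  toL2 (formCoeff coordA coordB (star coordA) (star coordB) i k l)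

/-- The equivariant map from `V_N` to `L²(G₀)` given by the matrix coefficients of index `i`. -/
def coeffMap (N i : ℕ) : V N →ₗ[ℂ] L2G₀ :=
  toL2.toLinearMap ∘ₗ ((Polynomial.lcoeff C(G₀, ℂ) i).restrictScalars ℂ) ∘ₗ
    (evalForms coordA coordB (star coordA) (star coordB)).toLinearMap ∘ₗ (V N).subtype

theorem coeffMap_mono {N : ℕ} (i k l : ℕ) (h : k + l = N) :
    coeffMap N i (mono k l h) = matrixCoeff i k l := by
  simp [coeffMap, mono, matrixCoeff, formCoeff]

theorem coeffMap_actV (N i : ℕ) (g : G₀) (v : V N) :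
    coeffMap N i (actV N g v) = rightTranslation g (coeffMap N i v) := by
  have h := evalForms_substitution (a := coordA) (b := coordB) (a' := star coordA)
    (b' := star coordB) (g : ℍ[ℝ]) (α := coordA g) (β := coordB g) rfl rfl (rightComp g)
    (by ext x; simp [coordA_mul, mul_comm]) (by ext x; simp [coordB_mul, mul_comm])
    (by ext x; simp [coordA_mul, mul_comm]) (by ext x; simp [coordB_mul, mul_comm]) v.1
  change toL2 ((evalForms coordA coordB (star coordA) (star coordB) (substitution g v.1)).coeff i) =
    rightTranslation g (toL2 ((evalForms coordA coordB (star coordA) (star coordB) v.1).coeff i))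
  rw [h, rightTranslation_toL2, Polynomial.coe_mapAlgHom, Polynomial.coeff_map]
  rfl

theorem range_le_W {N : ℕ} {T : V N →ₗ[ℂ] L2G₀}
    (hT : ∀ (g : G₀) (v : V N), T (actV N g v) = rightTranslation g (T v)) (v : V N) :
    T v ∈ W N :=
  Submodule.mem_iSup_of_mem T (Submodule.mem_iSup_of_mem hT (LinearMap.mem_range_self T v))

theorem matrixCoeff_mem_W (i k l : ℕ) : matrixCoeff i k l ∈ W (k + l) := by
  rw [← coeffMap_mono i k l rfl]
  exact range_le_W (coeffMap_actV _ i) _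

theorem W_le {N : ℕ} {Q : Submodule ℂ L2G₀} (h : ∀ T : V N →ₗ[ℂ] L2G₀,
    (∀ (g : G₀) (v : V N), T (actV N g v) = rightTranslation g (T v)) → ∀ v, T v ∈ Q) : W N ≤ Q := by
  refine iSup_le fun T => iSup_le fun hT => ?_
  rintro _ ⟨v, rfl⟩
  exact h T hT v

/-- Completeness of the matrix coefficients: the orthogonal complement of `F` is closed and contains
them, hence contains the image of all of `C(G₀)` by `dense_formSpan`, hence is everything. -/
theorem eq_zero_of_inner_matrixCoeff (F : L2G₀) (h : ∀ i k l, inner ℂ (matrixCoeff i k l) F = 0) :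
    F = 0 := by
  have hdense : DenseRange toL2 := ContinuousMap.toLp_denseRange ℂ haarG₀ ℂ (by simp)
  set K : Submodule ℂ L2G₀ := (ℂ ∙ F)ᗮ with hK
  have hKc : IsClosed (K : Set L2G₀) := Submodule.isClosed_orthogonal _
  have h1 : formSpan coordA coordB (star coordA) (star coordB) ≤ K.comap toL2.toLinearMap := by
    refine Submodule.span_le.2 ?_
    rintro _ ⟨z, rfl⟩
    change toL2 _ ∈ K
    rw [hK, Submodule.mem_orthogonal_singleton_iff_inner_left]
    exact h _ _ _
  have h2 : ∀ f, toL2 f ∈ K := by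
    intro f
    have hf : f ∈ (formSpan coordA coordB (star coordA) (star coordB)).topologicalClosure := by
      rw [dense_formSpan]; trivial
    exact Submodule.topologicalClosure_minimal _ h1 (hKc.preimage toL2.continuous) hf
  have h3 : F ∈ K := hdense.induction_on (p := fun y => y ∈ K) F hKc h2
  rw [hK, Submodule.mem_orthogonal_singleton_iff_inner_left] at h3
  exact inner_self_eq_zero.1 h3

/-! ### Torus weights and orthogonality of the isotypical components. -/

theorem inner_eq_zero_of_eigen {E : Type*} [NormedAddCommGroup E] [InnerProductSpace ℂ E]
    (U : E →ₗᵢ[ℂ] E) {f g : E} {α β : ℂ} (hf : U f = α • f) (hg : U g = β • g) (hα : ‖α‖ = 1)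
    (h : α ≠ β) : inner ℂ f g = 0 := by
  have h1 := U.inner_map_map f g
  rw [hf, hg, inner_smul_left, inner_smul_right, ← mul_assoc] at h1
  by_contra h0
  have h2 : conj α * β = 1 := mul_right_cancel₀ h0 (h1.trans (one_mul _).symm)
  have h3 : α * conj α = 1 := by rw [Complex.mul_conj, Complex.normSq_eq_norm_sq, hα]; norm_num
  apply h
  calc α = α * (conj α * β) := by rw [h2, mul_one]
    _ = β := by rw [← mul_assoc, h3, one_mul]

/-- A complex number of modulus one and infinite order. -/
def phase : ℂ := Complex.exp Complex.I

theorem norm_phase : ‖phase‖ = 1 := by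
  simpa [phase] using Complex.norm_exp_ofReal_mul_I 1

theorem phase_ne_zero : phase ≠ 0 := Complex.exp_ne_zero _

theorem conj_phase : conj phase = phase⁻¹ := by
  rw [Complex.inv_def, Complex.normSq_eq_norm_sq, norm_phase]
  simp

/-- `e^i` is not a root of unity because `π` is irrational. Consequently a single torus element
distinguishes all integral weights, and no integration over the torus is needed. -/
theorem phase_zpow_injective {m n : ℤ} (h : phase ^ m = phase ^ n) : m = n := by
  have h1 : phase ^ (m - n) = 1 := by
    rw [zpow_sub₀ phase_ne_zero, h, div_self (zpow_ne_zero _ phase_ne_zero)]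
  rw [phase, ← Complex.exp_int_mul, Complex.exp_eq_one_iff] at h1
  obtain ⟨k, hk⟩ := h1
  have h2 : ((m - n : ℤ) : ℝ) = k * (2 * Real.pi) := by
    have h3 := congrArg Complex.im hk
    simpa using h3
  by_contra hmn
  have hk0 : k ≠ 0 := by
    rintro rfl
    simp only [Int.cast_zero, zero_mul, Int.cast_eq_zero] at h2
    omega
  refine irrational_pi ⟨((m - n : ℤ) : ℚ) / (2 * k), ?_⟩
  have hk' : (k : ℝ) ≠ 0 := Int.cast_ne_zero.2 hk0
  rw [Rat.cast_div, Rat.cast_intCast, h2]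
  push_cast
  field_simp

/-- A unit quaternion of infinite order in the diagonal torus. -/
def torus : G₀ := ofCoords phase 0 (by simp [norm_phase])

theorem actV_torus_mono {N : ℕ} (k l : ℕ) (h : k + l = N) :
    actV N torus (mono k l h) = phase ^ ((k : ℤ) - l) • (mono k l h : V N) := by
  apply Subtype.ext
  have h0 : substitution torus (MvPolynomial.X 0) = MvPolynomial.C phase * MvPolynomial.X 0 := by
    refine (substitution_X_zero _).trans ?_
    change MvPolynomial.C phase * MvPolynomial.X 0 - MvPolynomial.C (conj 0) * MvPolynomial.X 1 = _
    simp
  have h1 : substitution torus (MvPolynomial.X 1) =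
      MvPolynomial.C phase⁻¹ * MvPolynomial.X 1 := by
    refine (substitution_X_one _).trans ?_
    change MvPolynomial.C 0 * MvPolynomial.X 0 + MvPolynomial.C (conj phase) * MvPolynomial.X 1 = _
    simp [conj_phase]
  rw [coe_actV]
  simp only [mono, map_mul, map_pow, h0, h1, SetLike.val_smul, MvPolynomial.smul_eq_C_mul, mul_pow]
  rw [zpow_sub₀ phase_ne_zero, zpow_natCast, zpow_natCast, div_eq_mul_inv, ← inv_pow, map_mul,
    map_pow, map_pow]
  ring

theorem norm_phase_zpow (n : ℤ) : ‖phase ^ n‖ = 1 := by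
  rw [norm_zpow, norm_phase, one_zpow]

theorem inner_rightTranslation_left (g : G₀) (F F' : L2G₀) :
    inner ℂ F (rightTranslation g F') = inner ℂ (rightTranslation g⁻¹ F) F' := by
  rw [← (rightTranslation g).inner_map_map (rightTranslation g⁻¹ F) F']
  congr 1
  refine Lp.ext ?_
  filter_upwards [rightTranslation_coeFn g (rightTranslation g⁻¹ F),
    (measurePreserving_mul_right g).quasiMeasurePreserving.ae (rightTranslation_coeFn g⁻¹ F)]
    with x h1 h2
  rw [h1, h2, mul_inv_cancel_right]

/-- The weights of `V_M` are at most `M < N`, so the image of `A^N`, of weight `N`, is orthogonal to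
every image of `V_M`. Translations are unitary and preserve the images of `V_M`, so the same holds
for all translates of `A^N`, which span `V_N`. -/
theorem inner_eq_zero_of_lt {M N : ℕ} (hMN : M < N) {T : V N →ₗ[ℂ] L2G₀} {T' : V M →ₗ[ℂ] L2G₀}
    (hT : ∀ (g : G₀) (v : V N), T (actV N g v) = rightTranslation g (T v))
    (hT' : ∀ (g : G₀) (v : V M), T' (actV M g v) = rightTranslation g (T' v)) (v : V N) (w : V M) :
    inner ℂ (T' w) (T v) = 0 := by
  have h0 : ∀ w : V M, inner ℂ (T' w) (T (mono N 0 (add_zero N))) = 0 := by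
    intro w
    have htop : ((ℂ ∙ T (mono N 0 (add_zero N)))ᗮ).comap T' = ⊤ := by
      refine eq_top_of_mono_mem _ fun k l hkl => ?_
      rw [Submodule.mem_comap, Submodule.mem_orthogonal_singleton_iff_inner_left]
      refine inner_eq_zero_of_eigen (rightTranslation torus) (α := phase ^ ((k : ℤ) - l))
        (β := phase ^ ((N : ℤ) - (0 : ℕ))) ?_ ?_ (norm_phase_zpow _) ?_
      · rw [← hT', actV_torus_mono, map_smul]
      · rw [← hT, actV_torus_mono, map_smul]
      · intro h
        have := phase_zpow_injective h
        omega
    have h1 : w ∈ ((ℂ ∙ T (mono N 0 (add_zero N)))ᗮ).comap T' := by rw [htop]; trivial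
    rwa [Submodule.mem_comap, Submodule.mem_orthogonal_singleton_iff_inner_left] at h1
  have htop : ((ℂ ∙ T' w)ᗮ).comap T = ⊤ := by
    refine eq_top_of_actV_mem _ fun g => ?_
    rw [Submodule.mem_comap, Submodule.mem_orthogonal_singleton_iff_inner_right, hT,
      inner_rightTranslation_left, ← hT']
    exact h0 _
  have h1 : v ∈ ((ℂ ∙ T' w)ᗮ).comap T := by rw [htop]; trivial
  rwa [Submodule.mem_comap, Submodule.mem_orthogonal_singleton_iff_inner_right] at h1

theorem W_le_orthogonal {M N : ℕ} (hMN : M ≠ N) : W N ≤ (W M)ᗮ := by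
  refine W_le fun T hT v => ?_
  rw [Submodule.mem_orthogonal]
  intro F hF
  suffices h : W M ≤ (ℂ ∙ T v)ᗮ from
    (Submodule.mem_orthogonal_singleton_iff_inner_left).1 (h hF)
  refine W_le fun T' hT' w => ?_
  rw [Submodule.mem_orthogonal_singleton_iff_inner_left]
  rcases lt_or_gt_of_ne hMN with h | h
  · exact inner_eq_zero_of_lt h hT hT' v w
  · rw [← inner_conj_symm, inner_eq_zero_of_lt h hT' hT w v, map_zero]

theorem inner_eq_zero_of_mem_W {M N : ℕ} (hMN : M ≠ N) {F F' : L2G₀} (hF : F ∈ W M)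
    (hF' : F' ∈ W N) : inner ℂ F F' = 0 :=
  (Submodule.mem_orthogonal _ _).1 (W_le_orthogonal hMN hF') F hF

/-- The isotypical component `W_N` is contained in the closed span of the matrix coefficients of
`V_N`. -/
theorem W_le_closure (N : ℕ) :
    W N ≤ (⨆ i : ℕ, LinearMap.range (coeffMap N i)).topologicalClosure := by
  set D := (⨆ i : ℕ, LinearMap.range (coeffMap N i)).topologicalClosure with hD
  have hDW : D ≤ (W N).topologicalClosure := by
    refine Submodule.topologicalClosure_mono (iSup_le fun i => ?_)
    rintro _ ⟨v, rfl⟩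
    exact range_le_W (coeffMap_actV N i) v
  have hDc : IsClosed (D : Set L2G₀) := Submodule.isClosed_topologicalClosure _
  have : CompleteSpace D := hDc.completeSpace_coe
  intro F hF
  have hP : D.starProjection F ∈ D := D.starProjection_apply_mem F
  suffices h : F - D.starProjection F = 0 by
    rw [sub_eq_zero.1 h]
    exact hP
  -- Matrix coefficients of degree `N` lie in `D`, to which the difference is orthogonal; those of
  -- another degree are orthogonal to the closure of `W N`, where both terms lie.
  refine eq_zero_of_inner_matrixCoeff _ fun i k l => ?_
  by_cases hkl : k + l = N
  · have h1 : matrixCoeff i k l ∈ D := by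
      rw [← coeffMap_mono i k l hkl]
      exact Submodule.le_topologicalClosure _
        (Submodule.mem_iSup_of_mem i (LinearMap.mem_range_self _ _))
    exact (Submodule.mem_orthogonal _ _).1 (D.sub_starProjection_mem_orthogonal F) _ h1
  · have h1 : (W N).topologicalClosure ≤ (W (k + l))ᗮ :=
      Submodule.topologicalClosure_minimal _ (W_le_orthogonal hkl) (Submodule.isClosed_orthogonal _)
    have h2 : F - D.starProjection F ∈ (W (k + l))ᗮ :=
      sub_mem (W_le_orthogonal hkl hF) (h1 (hDW hP))
    exact (Submodule.mem_orthogonal _ _).1 h2 _ (matrixCoeff_mem_W i k l)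

/-! ### Operators which commute with the translations of `G₀` -/

section forms

variable {R : Type*} [CommRing R]

theorem coeff_formP_pow (a b' : R) (N m : ℕ) :
    (formP a b' ^ N).coeff m = N.choose m * (a ^ m * (-b') ^ (N - m)) := by
  have h : formP a b' ^ N = ∑ i ∈ Finset.range (N + 1),
      Polynomial.C ((N.choose i : R) * (a ^ i * (-b') ^ (N - i))) * .X ^ i := by
    rw [formP, sub_eq_add_neg, ← map_neg, add_pow]
    refine Finset.sum_congr rfl fun i _ => ?_
    simp only [map_mul, map_pow, map_natCast]
    ring
  rw [h, Polynomial.finsetSum_coeff]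
  simp only [Polynomial.coeff_C_mul_X_pow, Finset.sum_ite_eq, Finset.mem_range]
  split_ifs with hm
  · rfl
  · rw [Nat.choose_eq_zero_of_lt (by omega)]
    simp

variable [Algebra ℂ R] {a b a' b' : R}

/-- Applying `φ` to either form amounts to the substitution `c ↦ ζ² c` followed by multiplication by
`ζ⁻¹`. So the index `i` records the weight under left translation, while `k` and `l` record the
weight under right translation. -/
theorem map_formCoeff_diagonal {ζ : ℂ} (hζ : ζ ≠ 0) (φ : R →ₐ[ℂ] R) (ha : φ a = ζ • a)
    (hb : φ b = ζ • b) (ha' : φ a' = ζ⁻¹ • a') (hb' : φ b' = ζ⁻¹ • b') (i k l : ℕ) :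
    φ (formCoeff a b a' b' i k l) = ζ ^ (2 * (i : ℤ) - (k + l : ℕ)) • formCoeff a b a' b' i k l := by
  set z : R := algebraMap ℂ R ζ
  set y : R := algebraMap ℂ R ζ⁻¹
  have hyz : y * z = 1 := by rw [← map_mul, inv_mul_cancel₀ hζ, map_one]
  have hyzC : Polynomial.C y * Polynomial.C z = 1 := by rw [← map_mul, hyz, map_one]
  have hP : (formP a b').map φ = .C y * (formP a b').comp (.C (z ^ 2) * .X) := by
    have h1 : (formP a b').map (φ : R →+* R) = .C (z * a) * .X - .C (y * b') := by
      simp [formP, ha, hb', Algebra.smul_def, z, y]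
    rw [h1]
    simp only [formP, Polynomial.sub_comp, Polynomial.mul_comp, Polynomial.C_comp,
      Polynomial.X_comp, map_mul, map_pow]
    linear_combination (-(Polynomial.C z * Polynomial.C a * Polynomial.X)) * hyzC
  have hQ : (formQ b a').map φ = .C y * (formQ b a').comp (.C (z ^ 2) * .X) := by
    have h1 : (formQ b a').map (φ : R →+* R) = .C (z * b) * .X + .C (y * a') := by
      simp [formQ, ha', hb, Algebra.smul_def, z, y]
    rw [h1]
    simp only [formQ, Polynomial.add_comp, Polynomial.mul_comp, Polynomial.C_comp,
      Polynomial.X_comp, map_mul, map_pow]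
    linear_combination (-(Polynomial.C z * Polynomial.C b * Polynomial.X)) * hyzC
  have h2 : (formP a b' ^ k * formQ b a' ^ l).map φ =
      .C (y ^ (k + l)) * (formP a b' ^ k * formQ b a' ^ l).comp (.C (z ^ 2) * .X) := by
    rw [Polynomial.map_mul, Polynomial.map_pow, Polynomial.map_pow, hP, hQ, Polynomial.mul_comp,
      Polynomial.pow_comp, Polynomial.pow_comp, map_pow Polynomial.C y]
    ring
  have h3 := congrArg (Polynomial.coeff · i) h2
  simp only [Polynomial.coeff_map, Polynomial.coeff_C_mul, Polynomial.comp_C_mul_X_coeff] at h3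
  change φ (formCoeff a b a' b' i k l) = _ at h3
  rw [h3, Algebra.smul_def, zpow_sub₀ hζ, zpow_mul, zpow_natCast, zpow_natCast, div_eq_mul_inv,
    ← inv_pow, map_mul, map_pow, map_pow]
  change y ^ (k + l) * (formCoeff a b a' b' i k l * (z ^ 2) ^ i) = _
  have : (algebraMap ℂ R) (ζ ^ (2 : ℤ)) = z ^ 2 := map_pow (algebraMap ℂ R) ζ 2
  rw [this]
  ring

end forms

theorem leftTranslation_torus_matrixCoeff (i k l : ℕ) :
    leftTranslation torus (matrixCoeff i k l) =
      phase ^ (2 * (i : ℤ) - (k + l : ℕ)) • matrixCoeff i k l := by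
  have hA : coordA torus = phase := rfl
  have hB : coordB torus = 0 := rfl
  rw [matrixCoeff, leftTranslation_toL2, map_formCoeff_diagonal phase_ne_zero (leftComp torus),
    toL2.map_smul]
  · ext x; simp [coordA_mul, hA, hB]
  · ext x; simp [coordB_mul, hA, hB]
  · ext x; simp [coordA_mul, hA, hB, conj_phase]
  · ext x; simp [coordB_mul, hA, hB, conj_phase]

theorem rightTranslation_torus_matrixCoeff (i k l : ℕ) :
    rightTranslation torus (matrixCoeff i k l) = phase ^ ((k : ℤ) - l) • matrixCoeff i k l := by
  rw [← coeffMap_mono i k l rfl, ← coeffMap_actV, actV_torus_mono, map_smul]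

/-- `matrixCoeff 0 N 0` is `(-B̄)^N`, and the chosen quaternion moves `-B̄` to `aA + b(-B̄)`. The
binomial coefficients of the expansion are already contained in `matrixCoeff m N 0`, the coefficient
of `c^m` in `(cA - B̄)^N`. -/
theorem leftTranslation_matrixCoeff_zero (N : ℕ) (a b : ℂ) (h : ‖a‖ ^ 2 + ‖b‖ ^ 2 = 1) :
    leftTranslation (ofCoords (conj b) (-conj a) (by simpa [add_comm] using h))
      (matrixCoeff 0 N 0) =
      ∑ m ∈ Finset.range (N + 1), (a ^ m * b ^ (N - m)) • matrixCoeff m N 0 := by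
  simp only [matrixCoeff, leftTranslation_toL2, ← toL2.map_smul]
  refine Eq.trans (congrArg toL2 ?_) (map_sum toL2.toLinearMap _ _)
  simp only [formCoeff, pow_zero, mul_one, coeff_formP_pow]
  set g := ofCoords (conj b) (-conj a) (by simpa [add_comm] using h) with hg
  have hB : leftComp g (-star coordB) = a • coordA + b • (-star coordB) := by
    ext x
    have hA' : coordA g = conj b := rfl
    have hB' : coordB g = -conj a := rfl
    simp [coordB_mul, hA', hB']
  simp only [Nat.choose_zero_right, Nat.cast_one, one_mul, Nat.sub_zero, map_pow, hB, add_pow]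
  refine Finset.sum_congr rfl fun m _ => ?_
  rw [smul_pow, smul_pow, smul_mul_smul_comm, smul_mul_assoc, mul_comm (_ * _) (Nat.cast _)]

instance : haarG₀.IsOpenPosMeasure := by
  unfold haarG₀
  exact Measure.isOpenPosMeasure_smul _ (ENNReal.ofReal_pos.2 (by positivity)).ne'

theorem matrixCoeff_zero_ne_zero (N : ℕ) : matrixCoeff 0 N 0 ≠ 0 := by
  intro h
  have h1 : formCoeff coordA coordB (star coordA) (star coordB) 0 N 0 = 0 := by
    refine ContinuousMap.toLp_injective (p := 2) (𝕜 := ℂ) haarG₀ ?_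
    exact h.trans (toL2.map_zero).symm
  -- At the point `A = 0`, `B = 1` the function `(-B̄)^N` takes the value `(-1)^N`.
  have h2 := congrArg (fun f : C(G₀, ℂ) => f (ofCoords 0 1 (by simp))) h1
  simp [formCoeff, coeff_formP_pow] at h2

theorem matrixCoeff_of_lt {i N : ℕ} (h : N < i) : matrixCoeff i N 0 = 0 := by
  rw [matrixCoeff, formCoeff, pow_zero, mul_one, coeff_formP_pow, Nat.choose_eq_zero_of_lt h,
    Nat.cast_zero, zero_mul]
  exact toL2.map_zero

theorem map_mem_W {S : L2G₀ →L[ℂ] L2G₀}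
    (hR : ∀ g F, S (rightTranslation g F) = rightTranslation g (S F)) {N : ℕ} {F : L2G₀}
    (hF : F ∈ W N) : S F ∈ W N := by
  suffices h : W N ≤ (W N).comap S.toLinearMap from h hF
  refine W_le fun T hT v => ?_
  refine range_le_W (T := S.toLinearMap ∘ₗ T) (fun g v => ?_) v
  simp [hT, hR]

/-- A bounded operator which commutes with the translations of `G₀` acts on `W_N` as a scalar. -/
theorem eq_smul_of_mem_W {S : L2G₀ →L[ℂ] L2G₀}
    (hR : ∀ g F, S (rightTranslation g F) = rightTranslation g (S F))
    (hL : ∀ g F, S (leftTranslation g F) = leftTranslation g (S F)) {N : ℕ} {F : L2G₀}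
    (hF : F ∈ W N) :
    S F = (inner ℂ (matrixCoeff 0 N 0) (S (matrixCoeff 0 N 0)) /
      inner ℂ (matrixCoeff 0 N 0) (matrixCoeff 0 N 0)) • F := by
  set f := matrixCoeff 0 N 0 with hf
  set c : ℂ := inner ℂ f (S f) / inner ℂ f f with hc
  have hff : inner ℂ f f ≠ 0 := inner_self_eq_zero.not.2 (matrixCoeff_zero_ne_zero N)
  have hfW : f ∈ W N := matrixCoeff_mem_W 0 N 0
  -- `S f` has the torus weights of `f`: `-N` on the left and `N` on the right. Among the matrix
  -- coefficients of degree `N`, of weights `2i - N` and `k - l`, only `f` has both, and `c` is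
  -- chosen to make the product with `f` vanish.
  have h0 : S f = c • f := by
    rw [← sub_eq_zero]
    refine eq_zero_of_inner_matrixCoeff _ fun i k l => ?_
    by_cases hkl : k + l = N
    · by_cases hl : l = 0
      · subst hl
        obtain rfl : k = N := hkl
        by_cases hi : i = 0
        · subst hi
          rw [← hf, inner_sub_right, inner_smul_right, hc, div_mul_cancel₀ _ hff, sub_self]
        · refine inner_eq_zero_of_eigen (leftTranslation torus)
            (leftTranslation_torus_matrixCoeff i k 0) (β := phase ^ (2 * ((0 : ℕ) : ℤ) - (k + 0 : ℕ)))
            ?_ (norm_phase_zpow _) ?_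
          · rw [map_sub, map_smul, ← hL, hf, leftTranslation_torus_matrixCoeff, map_smul, smul_sub,
              smul_comm c]
          · intro h
            have := phase_zpow_injective h
            omega
      · refine inner_eq_zero_of_eigen (rightTranslation torus)
          (rightTranslation_torus_matrixCoeff i k l) (β := phase ^ ((N : ℤ) - (0 : ℕ)))
          ?_ (norm_phase_zpow _) ?_
        · rw [map_sub, map_smul, ← hR, hf, rightTranslation_torus_matrixCoeff, map_smul, smul_sub,
            smul_comm c]
        · intro h
          have := phase_zpow_injective h
          omega
    · exact inner_eq_zero_of_mem_W hkl (matrixCoeff_mem_W i k l)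
        (sub_mem (map_mem_W hR hfW) ((W N).smul_mem c hfW))
  set Q : Submodule ℂ L2G₀ := LinearMap.ker (S - c • ContinuousLinearMap.id ℂ L2G₀).toLinearMap
    with hQ
  have hmem : ∀ x, x ∈ Q ↔ S x = c • x := fun x => by
    rw [hQ, LinearMap.mem_ker]
    simp [sub_eq_zero]
  have hQc : IsClosed (Q : Set L2G₀) := (S - c • ContinuousLinearMap.id ℂ L2G₀).isClosed_ker
  -- Left translates of `f` lie in `Q`, and polarization extracts the individual coefficients from
  -- them; right translates of these then fill the image of each `coeffMap N i`.
  have hrow : ∀ i, matrixCoeff i N 0 ∈ Q := by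
    intro i
    by_cases hi : i ≤ N
    · refine mem_of_forall_unit_sum_mem Q N (fun m => matrixCoeff m N 0) (fun a b hab => ?_) hi
      rw [← leftTranslation_matrixCoeff_zero N a b hab, hmem, hL, ← hf, h0, map_smul]
    · rw [matrixCoeff_of_lt (not_le.1 hi)]
      exact Q.zero_mem
  have hall : ∀ i v, coeffMap N i v ∈ Q := by
    intro i v
    have htop : Q.comap (coeffMap N i) = ⊤ := by
      refine eq_top_of_actV_mem _ fun g => ?_
      have h1 := (hmem _).1 (hrow i)
      rw [Submodule.mem_comap, coeffMap_actV, coeffMap_mono, hmem, hR, h1, map_smul]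
    have h1 : v ∈ Q.comap (coeffMap N i) := by rw [htop]; trivial
    exact h1
  rw [← hmem]
  refine Submodule.topologicalClosure_minimal _ (iSup_le fun i => ?_) hQc (W_le_closure N hF)
  rintro _ ⟨v, rfl⟩
  exact hall i v

/-! ### Multiplication operators -/

section multiplier

variable {α : Type*} [MeasurableSpace α] {μ : Measure α}

/-- An `L²` limit is an almost everywhere limit along a subsequence; extracting twice makes both the
vectors and their images converge pointwise. -/
theorem isClosed_multiplier (M : Lp ℂ 2 μ →L[ℂ] Lp ℂ 2 μ) (a : α → ℂ) :
    IsClosed {f : Lp ℂ 2 μ | M f =ᵐ[μ] fun x => a x * f x} := by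
  refine IsSeqClosed.isClosed fun f g hf hfg => ?_
  obtain ⟨n, hn, h1⟩ := (tendstoInMeasure_of_tendsto_Lp hfg).exists_seq_tendsto_ae
  have h2 : Tendsto (fun i => M (f (n i))) atTop (𝓝 (M g)) :=
    ((M.continuous.tendsto g).comp hfg).comp hn.tendsto_atTop
  obtain ⟨m, hm, h3⟩ := (tendstoInMeasure_of_tendsto_Lp h2).exists_seq_tendsto_ae
  have hf' : ∀ᵐ x ∂μ, ∀ i, M (f i) x = a x * f i x := ae_all_iff.2 hf
  filter_upwards [h1, h3, hf'] with x hx1 hx3 hx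
  have h4 : Tendsto (fun i => a x * f (n (m i)) x) atTop (𝓝 (a x * g x)) :=
    (hx1.comp hm.tendsto_atTop).const_mul _
  exact tendsto_nhds_unique (hx3.congr fun i => hx _) h4

/-- Testing on the indicator of a set `s` of finite measure gives `∫_s |a|² ≤ ‖M‖² μ(s)`, hence `|a|
≤ ‖M‖` almost everywhere. -/
theorem memLp_top_of_multiplier [SigmaFinite μ] (M : Lp ℂ 2 μ →L[ℂ] Lp ℂ 2 μ) {a : α → ℂ}
    (ha : AEStronglyMeasurable a μ) (h : ∀ f : Lp ℂ 2 μ, M f =ᵐ[μ] fun x => a x * f x) :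
    MemLp a ∞ μ := by
  have hle : (fun x => ‖a x‖ₑ ^ 2) ≤ᵐ[μ] fun _ => ENNReal.ofReal (‖M‖ ^ 2) := by
    refine ae_le_of_forall_setLIntegral_le_of_sigmaFinite₀ (by fun_prop) fun s hs hμs => ?_
    set f : Lp ℂ 2 μ := indicatorConstLp 2 hs hμs.ne 1 with hf
    have h1 : ∫⁻ x in s, ‖a x‖ₑ ^ 2 ∂μ = ‖M f‖ₑ ^ 2 := by
      rw [Lp.enorm_def, eLpNorm_eq_lintegral_rpow_enorm_toReal (by simp) (by simp),
        ENNReal.toReal_ofNat, ← ENNReal.rpow_natCast, ← ENNReal.rpow_mul]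
      norm_num
      rw [← lintegral_indicator hs]
      refine lintegral_congr_ae ?_
      filter_upwards [h f, indicatorConstLp_coeFn (p := 2) (hs := hs) (hμs := hμs.ne)
        (c := (1 : ℂ))] with x hx1 hx2
      rw [hx1, hf, hx2]
      by_cases hx : x ∈ s <;> simp [hx]
    have h2 : ‖f‖ₑ ^ 2 = μ s := by
      rw [hf, Lp.enorm_def, eLpNorm_congr_ae indicatorConstLp_coeFn, eLpNorm_indicator_const hs
        (by simp) (by simp), ← ENNReal.rpow_natCast, ENNReal.mul_rpow_of_nonneg _ _ (by simp),
        ← ENNReal.rpow_mul]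
      norm_num
    rw [h1, setLIntegral_const, ← h2, ENNReal.ofReal_pow (norm_nonneg _), ofReal_norm, ← mul_pow]
    gcongr
    exact M.le_opENorm f
  refine memLp_top_of_bound ha ‖M‖ ?_
  filter_upwards [hle] with x hx
  rw [← ofReal_norm, ← ENNReal.ofReal_pow (norm_nonneg _),
    ENNReal.ofReal_le_ofReal_iff (by positivity)] at hx
  exact (pow_le_pow_iff_left₀ (norm_nonneg _) (norm_nonneg _) two_ne_zero).1 hx

/-- A bounded operator which acts on a total set of multiples `e h` of a nowhere vanishing function
`h` by `e h ↦ e M(h)` is the multiplication by an essentially bounded function. -/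
theorem exists_multiplier [SigmaFinite μ] (M : Lp ℂ 2 μ →L[ℂ] Lp ℂ 2 μ) (h : Lp ℂ 2 μ)
    (h0 : ∀ᵐ x ∂μ, h x ≠ 0) (D : Set (Lp ℂ 2 μ))
    (hD : (Submodule.span ℂ D).topologicalClosure = ⊤)
    (hM : ∀ f ∈ D, ∃ e : α → ℂ, (f =ᵐ[μ] fun x => e x * h x) ∧ M f =ᵐ[μ] fun x => e x * M h x) :
    ∃ a : Lp ℂ ∞ μ, ∀ f : Lp ℂ 2 μ, M f =ᵐ[μ] fun x => a x * f x := by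
  -- The value on `h` forces this quotient; boundedness is known only after the identity has been
  -- extended to all of `L²`.
  set a : α → ℂ := fun x => M h x / h x with ha
  have ham : AEStronglyMeasurable a μ :=
    ((Lp.aestronglyMeasurable (M h)).aemeasurable.div
      (Lp.aestronglyMeasurable h).aemeasurable).aestronglyMeasurable
  let P : Submodule ℂ (Lp ℂ 2 μ) :=
    { carrier := {f | M f =ᵐ[μ] fun x => a x * f x}
      zero_mem' := by
        change M 0 =ᵐ[μ] _
        rw [map_zero]
        filter_upwards [Lp.coeFn_zero ℂ 2 μ] with x hx
        rw [hx]
        simp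
      add_mem' := by
        intro f g hf hg
        change M (f + g) =ᵐ[μ] _
        rw [map_add]
        filter_upwards [hf, hg, Lp.coeFn_add f g, Lp.coeFn_add (M f) (M g)] with x h1 h2 h3 h4
        rw [h3, h4, Pi.add_apply, Pi.add_apply, h1, h2, mul_add]
      smul_mem' := by
        intro c f hf
        change M (c • f) =ᵐ[μ] _
        rw [map_smul]
        filter_upwards [hf, Lp.coeFn_smul c f, Lp.coeFn_smul c (M f)] with x h1 h2 h3
        rw [h2, h3, Pi.smul_apply, Pi.smul_apply, h1, smul_eq_mul, smul_eq_mul]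
        ring }
  have hP : ∀ f : Lp ℂ 2 μ, M f =ᵐ[μ] fun x => a x * f x := by
    intro f
    have h1 : (Submodule.span ℂ D).topologicalClosure ≤ P := by
      refine Submodule.topologicalClosure_minimal _ (Submodule.span_le.2 fun f hf => ?_)
        (isClosed_multiplier M a)
      obtain ⟨e, he1, he2⟩ := hM f hf
      change M f =ᵐ[μ] _
      filter_upwards [he1, he2, h0] with x hx1 hx2 hx0
      rw [hx1, hx2, ha]
      field_simp
    have h2 : f ∈ P := h1 (by rw [hD]; trivial)
    exact h2
  have hmem := memLp_top_of_multiplier M ham hP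
  refine ⟨hmem.toLp a, fun f => ?_⟩
  filter_upwards [hP f, hmem.coeFn_toLp] with x hx1 hx2
  rw [hx1, hx2]

end multiplier

/-! ### The Mellin transform -/

section fourier

open FourierTransform

/-- The Fourier transform on `L²` agrees with the Fourier integral on `L¹ ∩ L²`. -/
theorem fourierTransform_toLp {f : ℝ → ℂ} (h1 : Integrable f) (h2 : MemLp f 2) :
    Lp.fourierTransformₗᵢ ℝ ℂ (h2.toLp f) =ᵐ[volume] 𝓕 f := by
  have hcont : Continuous (𝓕 f) :=
    VectorFourier.fourierIntegral_continuous Real.continuous_fourierChar (by fun_prop) h1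
  -- Both sides are tested against smooth compactly supported `g`. The `L²` transform is compatible
  -- with the transform of tempered distributions, and for the integral Fubini moves the transform
  -- onto `g`.
  refine ae_eq_of_integral_contDiff_smul_eq ((Lp.memLp _).locallyIntegrable (by norm_num))
    hcont.locallyIntegrable fun g hg hgc => ?_
  have hg₁ : HasCompactSupport (Complex.ofRealCLM ∘ g) := hgc.comp_left rfl
  have hg₂ : ContDiff ℝ ((⊤ : ℕ∞) : WithTop ℕ∞) (Complex.ofRealCLM ∘ g) := by fun_prop
  set G := hg₁.toSchwartzMap hg₂ with hG
  have hGg : ∀ x, G x = (g x : ℂ) := fun x => by simp [hG]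
  have h3 := congrArg (fun T => T G)
    (Lp.fourier_toTemperedDistribution_eq (E := ℝ) (F := ℂ) (h2.toLp f))
  simp only [TemperedDistribution.fourier_apply, Lp.toTemperedDistribution_apply] at h3
  have h4 : ∫ x, (𝓕 G) x • (h2.toLp f) x = ∫ x, (𝓕 (G : ℝ → ℂ)) x • f x := by
    refine integral_congr_ae ?_
    filter_upwards [h2.coeFn_toLp] with x hx
    rw [hx, SchwartzMap.fourier_coe]
  have h5 : ∫ x, (𝓕 (G : ℝ → ℂ)) x • f x = ∫ x, G x • (𝓕 f) x := by
    have := VectorFourier.integral_fourierIntegral_smul_eq_flip (μ := volume) (ν := volume)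
      (L := innerₗ ℝ) (e := Real.fourierChar) Real.continuous_fourierChar (by fun_prop)
      (G.integrable (μ := volume)) h1
    rw [flip_innerₗ] at this
    exact this
  have h6 : ∀ (F : ℝ → ℂ), ∫ x, g x • F x = ∫ x, G x • F x := fun F => by
    refine integral_congr_ae (Eventually.of_forall fun x => ?_)
    simp [hGg]
  rw [h6, h6, ← h5, ← h4]
  exact h3.symm

end fourier

/-- The isometric isomorphism of `L²` spaces given by composition with a measure preserving map which
has a measure preserving left inverse. -/
def compIso {α β : Type*} [MeasurableSpace α] [MeasurableSpace β] {μ : Measure α} {ν : Measure β}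
    {f : α → β} {g : β → α} (hf : MeasurePreserving f μ ν) (hg : MeasurePreserving g ν μ)
    (h : ∀ᵐ x ∂μ, g (f x) = x) : Lp ℂ 2 ν ≃ₗᵢ[ℂ] Lp ℂ 2 μ :=
  LinearIsometryEquiv.ofSurjective (Lp.compMeasurePreservingₗᵢ ℂ f hf) fun φ =>
    ⟨Lp.compMeasurePreserving g hg φ, by
      refine Lp.ext ?_
      filter_upwards [h, Lp.coeFn_compMeasurePreserving (Lp.compMeasurePreserving g hg φ) hf,
        hf.quasiMeasurePreserving.ae (Lp.coeFn_compMeasurePreserving φ hg)] with x h1 h2 h3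
      refine h2.trans ?_
      rw [Function.comp_apply, h3, Function.comp_apply, h1]⟩

theorem compIso_coeFn {α β : Type*} [MeasurableSpace α] [MeasurableSpace β] {μ : Measure α}
    {ν : Measure β} {f : α → β} {g : β → α} (hf : MeasurePreserving f μ ν)
    (hg : MeasurePreserving g ν μ) (h : ∀ᵐ x ∂μ, g (f x) = x) (φ : Lp ℂ 2 ν) :
    compIso hf hg h φ =ᵐ[μ] φ ∘ f :=
  Lp.coeFn_compMeasurePreserving φ hf

theorem measurePreserving_two_pi : MeasurePreserving (fun s => 2 * Real.pi * s) volume dτ := by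
  refine ⟨by fun_prop, ?_⟩
  rw [Real.map_volume_mul_left (by positivity), abs_of_pos (by positivity)]
  rfl

theorem measurePreserving_two_pi_inv :
    MeasurePreserving (fun s => (2 * Real.pi)⁻¹ * s) dτ volume := by
  refine ⟨by fun_prop, ?_⟩
  rw [← measurePreserving_two_pi.map_eq, Measure.map_map (by fun_prop) (by fun_prop)]
  have : ((fun s => (2 * Real.pi)⁻¹ * s) ∘ fun s => 2 * Real.pi * s) = id := by
    ext s
    simp only [Function.comp_apply, id]
    field_simp
  rw [this, Measure.map_id]

instance : SigmaFinite dτ := by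
  have : dτ.IsAddHaarMeasure :=
    Measure.IsAddHaarMeasure.smul (volume : Measure ℝ)
      (ENNReal.ofReal_pos.2 (by positivity)).ne' ENNReal.ofReal_ne_top
  infer_instance

/-- The Mellin transform `ψ ↦ ∫ ψ(τ) u^{-iτ} dτ / 2π` as a unitary operator. -/
def mellinIso : Lp ℂ 2 dτ ≃ₗᵢ[ℂ] L2R :=
  ((compIso measurePreserving_two_pi measurePreserving_two_pi_inv
    (Eventually.of_forall fun s => by field_simp)).trans (Lp.fourierTransformₗᵢ ℝ ℂ)).trans
    (compIso measurePreserving_log measurePreserving_exp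
      (by filter_upwards [ae_duu_pos] with u hu using Real.exp_log hu))

/-- With `τ = 2πs` the kernel `u^{-iτ}` is `e^{-2πi s log u}`, the Fourier kernel at `log u`; the
factor `1/2π` in `dτ` absorbs the change of variable. -/
theorem mellinIso_toLp {ψ : ℝ → ℂ} (h1 : Integrable ψ dτ) (h2 : MemLp ψ 2 dτ) :
    mellinIso (h2.toLp ψ) =ᵐ[duu] fun u => ∫ τ, ψ τ * (u : ℂ) ^ (-(τ * Complex.I)) ∂dτ := by
  have h3 : Integrable (ψ ∘ fun s => 2 * Real.pi * s) :=
    measurePreserving_two_pi.integrable_comp_of_integrable h1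
  have h4 := h2.comp_measurePreserving measurePreserving_two_pi
  have h5 := measurePreserving_log.quasiMeasurePreserving.ae (fourierTransform_toLp h3 h4)
  filter_upwards [h5, compIso_coeFn measurePreserving_log measurePreserving_exp
    (by filter_upwards [ae_duu_pos] with u hu using Real.exp_log hu)
    (Lp.fourierTransformₗᵢ ℝ ℂ (h4.toLp _)), ae_duu_pos] with u hu1 hu2 hu3
  refine hu2.trans (hu1.trans ?_)
  have hmeas : AEStronglyMeasurable (fun τ => ψ τ * (u : ℂ) ^ (-(τ * Complex.I)))
      (Measure.map (fun s => 2 * Real.pi * s) volume) := by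
    rw [measurePreserving_two_pi.map_eq]
    refine h2.aestronglyMeasurable.mul (Continuous.aestronglyMeasurable ?_)
    have : (u : ℂ) ≠ 0 := Complex.ofReal_ne_zero.2 hu3.ne'
    exact Continuous.const_cpow (by fun_prop) (Or.inl this)
  rw [Real.fourier_real_eq_integral_exp_smul, ← measurePreserving_two_pi.map_eq,
    integral_map measurePreserving_two_pi.measurable.aemeasurable hmeas]
  refine integral_congr_ae (Eventually.of_forall fun s => ?_)
  simp only [smul_eq_mul, Function.comp_apply]
  rw [mul_comm, Complex.cpow_def_of_ne_zero (Complex.ofReal_ne_zero.2 hu3.ne'),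
    ← Complex.ofReal_log hu3.le]
  congr 2
  push_cast
  ring

/-! ### Truncated Mellin integrals and the limit in the mean. -/

theorem memLp_truncation {ψ : ℝ → ℂ} (h : MemLp ψ 2 dτ) (Λ : ℝ) :
    MemLp ((Set.Ioc (-Λ) Λ).indicator ψ) 2 dτ := h.indicator measurableSet_Ioc

theorem integrable_truncation {ψ : ℝ → ℂ} (h : MemLp ψ 2 dτ) (Λ : ℝ) :
    Integrable ((Set.Ioc (-Λ) Λ).indicator ψ) dτ := by
  rw [integrable_indicator_iff measurableSet_Ioc]
  have : IsFiniteMeasure (dτ.restrict (Set.Ioc (-Λ) Λ)) := by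
    refine ⟨?_⟩
    rw [Measure.restrict_apply_univ, dτ, Measure.smul_apply, Real.volume_Ioc, smul_eq_mul]
    exact ENNReal.mul_lt_top ENNReal.ofReal_lt_top ENNReal.ofReal_lt_top
  exact (h.restrict _).integrable one_le_two

theorem tendsto_truncation {ψ : ℝ → ℂ} (h : MemLp ψ 2 dτ) :
    Tendsto (fun Λ : ℝ => (memLp_truncation h Λ).toLp _) atTop (𝓝 (h.toLp ψ)) := by
  rw [Lp.tendsto_Lp_iff_tendsto_eLpNorm'']
  have h2 : ∀ Λ : ℝ, eLpNorm ((Set.Ioc (-Λ) Λ).indicator ψ - ψ) 2 dτ =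
      (∫⁻ τ, ‖(Set.Ioc (-Λ) Λ).indicator ψ τ - ψ τ‖ₑ ^ 2 ∂dτ) ^ (1 / 2 : ℝ) := by
    intro Λ
    rw [eLpNorm_eq_lintegral_rpow_enorm_toReal (by simp) (by simp)]
    simp
  simp_rw [h2]
  have h3 : Tendsto (fun Λ : ℝ => ∫⁻ τ, ‖(Set.Ioc (-Λ) Λ).indicator ψ τ - ψ τ‖ₑ ^ 2 ∂dτ) atTop
      (𝓝 (∫⁻ _, 0 ∂dτ)) := by
    refine tendsto_lintegral_filter_of_dominated_convergence' (fun τ => ‖ψ τ‖ₑ ^ 2) ?_ ?_ ?_ ?_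
    · refine Eventually.of_forall fun Λ => ?_
      have := (memLp_truncation h Λ).aestronglyMeasurable.sub h.aestronglyMeasurable
      exact (this.enorm).pow_const 2
    · refine Eventually.of_forall fun Λ => Eventually.of_forall fun τ => ?_
      by_cases hτ : τ ∈ Set.Ioc (-Λ) Λ <;> simp [hτ]
    · have := lintegral_rpow_enorm_lt_top_of_eLpNorm_lt_top (by simp) (by simp) h.2
      simpa using this.ne
    · refine Eventually.of_forall fun τ => ?_
      refine tendsto_const_nhds.congr' ?_
      filter_upwards [eventually_gt_atTop |τ|] with Λ hΛ
      have : τ ∈ Set.Ioc (-Λ) Λ := ⟨(abs_lt.1 hΛ).1, (abs_lt.1 hΛ).2.le⟩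
      simp [this]
  rw [lintegral_zero] at h3
  have h4 := (ENNReal.continuous_rpow_const (y := (1 / 2 : ℝ))).tendsto 0 |>.comp h3
  rw [ENNReal.zero_rpow_of_pos (by norm_num)] at h4
  exact h4

theorem mellinIso_truncation {ψ : ℝ → ℂ} (h : MemLp ψ 2 dτ) {Λ : ℝ} (hΛ : 0 ≤ Λ) :
    mellinIso ((memLp_truncation h Λ).toLp _) =ᵐ[duu]
      fun u => ∫ τ in (-Λ)..Λ, ψ τ * (u : ℂ) ^ (-(τ * Complex.I)) ∂dτ := by
  refine (mellinIso_toLp (integrable_truncation h Λ) (memLp_truncation h Λ)).trans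
    (Eventually.of_forall fun u => ?_)
  simp only
  rw [intervalIntegral.integral_of_le (by linarith), ← integral_indicator measurableSet_Ioc]
  refine integral_congr_ae (Eventually.of_forall fun τ => ?_)
  by_cases hτ : τ ∈ Set.Ioc (-Λ) Λ <;> simp [hτ]

theorem isMellinLim_iff {ψ : ℝ → ℂ} (h : MemLp ψ 2 dτ) (G : L2R) :
    IsMellinLim ψ G ↔ G = mellinIso (h.toLp ψ) := by
  have h1 : Tendsto (fun Λ : ℝ => mellinIso ((memLp_truncation h Λ).toLp _)) atTop
      (𝓝 (mellinIso (h.toLp ψ))) :=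
    (mellinIso.continuous.tendsto _).comp (tendsto_truncation h)
  have h2 : IsMellinLim ψ G ↔
      Tendsto (fun Λ : ℝ => mellinIso ((memLp_truncation h Λ).toLp _)) atTop (𝓝 G) := by
    rw [tendsto_iff_edist_tendsto_0, IsMellinLim]
    refine tendsto_congr' ?_
    filter_upwards [eventually_ge_atTop 0] with Λ hΛ
    rw [edist_comm, Lp.edist_def]
    refine eLpNorm_congr_ae ?_
    filter_upwards [mellinIso_truncation h hΛ] with u hu
    rw [Pi.sub_apply, hu]
  rw [h2]
  exact ⟨fun h3 => tendsto_nhds_unique h3 h1, fun h3 => h3 ▸ h1⟩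

/-! ### Modulations and dilations -/

theorem memLp_modulation {ψ : ℝ → ℂ} (h : MemLp ψ 2 dτ) (s : ℝ) :
    MemLp (fun τ : ℝ => Complex.exp ((-(s * τ) : ℝ) * Complex.I) * ψ τ) 2 dτ := by
  refine h.of_le ?_ (Eventually.of_forall fun τ => ?_)
  · exact (Continuous.aestronglyMeasurable (by fun_prop)).mul h.aestronglyMeasurable
  · rw [norm_mul, Complex.norm_exp_ofReal_mul_I, one_mul]

/-- `(e^s u)^{-iτ} = e^{-isτ} u^{-iτ}`, read off on truncations, where the transform is an integral,
and extended by continuity. -/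
theorem mellinIso_modulation {ψ : ℝ → ℂ} (h : MemLp ψ 2 dτ) (s : ℝ) :
    mellinIso ((memLp_modulation h s).toLp _) = dilation s (mellinIso (h.toLp ψ)) := by
  have h1 : Tendsto (fun Λ : ℝ => mellinIso ((memLp_truncation (memLp_modulation h s) Λ).toLp _))
      atTop (𝓝 (mellinIso ((memLp_modulation h s).toLp _))) :=
    (mellinIso.continuous.tendsto _).comp (tendsto_truncation _)
  have h2 : Tendsto (fun Λ : ℝ => dilation s (mellinIso ((memLp_truncation h Λ).toLp _)))
      atTop (𝓝 (dilation s (mellinIso (h.toLp ψ)))) :=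
    (((dilation s).continuous.comp mellinIso.continuous).tendsto _).comp (tendsto_truncation h)
  refine tendsto_nhds_unique (h1.congr' ?_) h2
  filter_upwards [eventually_ge_atTop 0] with Λ hΛ
  refine Lp.ext ?_
  filter_upwards [mellinIso_truncation (memLp_modulation h s) hΛ, dilation_coeFn s
    (mellinIso ((memLp_truncation h Λ).toLp _)),
    (measurePreserving_dilation s).quasiMeasurePreserving.ae (mellinIso_truncation h hΛ),
    ae_duu_pos] with u hu1 hu2 hu3 hu4
  rw [hu1, hu2, hu3]
  refine intervalIntegral.integral_congr fun τ _ => ?_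
  have hu5 : 0 < Real.exp s * u := by positivity
  rw [Complex.cpow_def_of_ne_zero (Complex.ofReal_ne_zero.2 hu4.ne'),
    Complex.cpow_def_of_ne_zero (Complex.ofReal_ne_zero.2 hu5.ne'), ← Complex.ofReal_log hu4.le,
    ← Complex.ofReal_log hu5.le, Real.log_mul (Real.exp_pos s).ne' hu4.ne', Real.log_exp,
    mul_comm (Complex.exp _) (ψ τ), mul_assoc, ← Complex.exp_add]
  congr 2
  push_cast
  ring

/-- A positive weight function. -/
def weight (τ : ℝ) : ℂ := ((1 + τ ^ 2)⁻¹ : ℝ)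

theorem continuous_weight : Continuous weight := by
  unfold weight
  refine Complex.continuous_ofReal.comp (Continuous.inv₀ (by fun_prop) fun τ => ?_)
  positivity

theorem weight_ne_zero (τ : ℝ) : weight τ ≠ 0 := by
  have : (1 + τ ^ 2)⁻¹ ≠ 0 := by positivity
  exact Complex.ofReal_ne_zero.2 this

theorem norm_weight (τ : ℝ) : ‖weight τ‖ = (1 + τ ^ 2)⁻¹ := by
  rw [weight, Complex.norm_real, Real.norm_of_nonneg (by positivity)]

theorem norm_weight_le_one (τ : ℝ) : ‖weight τ‖ ≤ 1 := by
  rw [norm_weight]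
  exact inv_le_one_of_one_le₀ (by nlinarith [sq_nonneg τ])

theorem memLp_weight : MemLp weight 2 dτ := by
  have h1 : Integrable (fun τ : ℝ => (1 + τ ^ 2)⁻¹) dτ :=
    integrable_inv_one_add_sq.smul_measure ENNReal.ofReal_ne_top
  refine (memLp_two_iff_integrable_sq_norm continuous_weight.aestronglyMeasurable).2 ?_
  refine h1.mono' (continuous_weight.norm.pow 2).aestronglyMeasurable
    (Eventually.of_forall fun τ => ?_)
  have h2 := norm_weight_le_one τ
  rw [norm_pow, norm_norm, pow_two]
  calc ‖weight τ‖ * ‖weight τ‖ ≤ 1 * ‖weight τ‖ := by gcongr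
    _ = _ := by rw [one_mul, norm_weight]

/-- If `φ` is orthogonal to all modulations of `weight`, taking `s = -log u` shows that the Mellin
integral of `weight * φ` vanishes at almost every `u`. This product is both integrable and square
integrable, so injectivity of `mellinIso` makes it zero, and `weight` has no zeros. -/
theorem span_modulation_weight : (Submodule.span ℂ (Set.range fun s : ℝ =>
    (memLp_modulation memLp_weight s).toLp _)).topologicalClosure = ⊤ := by
  rw [Submodule.topologicalClosure_eq_top_iff, Submodule.eq_bot_iff]
  intro φ hφ
  have hmem : MemLp (fun τ => weight τ * φ τ) 2 dτ := by
    refine (Lp.memLp φ).of_le (continuous_weight.aestronglyMeasurable.mul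
      (Lp.aestronglyMeasurable φ)) (Eventually.of_forall fun τ => ?_)
    rw [norm_mul]
    exact mul_le_of_le_one_left (norm_nonneg _) (norm_weight_le_one τ)
  have hint : Integrable (fun τ => weight τ * φ τ) dτ := memLp_weight.integrable_mul (Lp.memLp φ)
  have hzero : mellinIso (hmem.toLp _) = 0 := by
    refine Lp.ext ?_
    filter_upwards [mellinIso_toLp hint hmem, Lp.coeFn_zero ℂ 2 duu, ae_duu_pos] with u h1 h2 h3
    rw [h1, h2, Pi.zero_apply, ← (Submodule.mem_orthogonal _ _).1 hφ _
      (Submodule.subset_span ⟨-Real.log u, rfl⟩), L2.inner_def]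
    refine integral_congr_ae ?_
    filter_upwards [(memLp_modulation memLp_weight (-Real.log u)).coeFn_toLp] with τ hτ
    rw [hτ, Complex.cpow_def_of_ne_zero (Complex.ofReal_ne_zero.2 h3.ne'),
      ← Complex.ofReal_log h3.le, RCLike.inner_apply, map_mul, ← Complex.exp_conj, map_mul,
      Complex.conj_I, Complex.conj_ofReal, weight, Complex.conj_ofReal]
    have : (Real.log u : ℂ) * -(τ * Complex.I) = ((-(-Real.log u * τ) : ℝ) : ℂ) * -Complex.I := by
      push_cast
      ring
    rw [this]
    ring
  have h0 := (LinearIsometryEquiv.map_eq_zero_iff mellinIso).1 hzero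
  refine Lp.ext ?_
  filter_upwards [hmem.coeFn_toLp, (Lp.eq_zero_iff_ae_eq_zero).1 h0, Lp.coeFn_zero ℂ 2 dτ]
    with τ h1 h2 h3
  rw [h3, Pi.zero_apply]
  rw [h1] at h2
  exact (mul_eq_zero.1 h2).resolve_left (weight_ne_zero τ)

theorem memLp_mul_of_top (a : Lp ℂ ∞ dτ) {ψ : ℝ → ℂ} (h : MemLp ψ 2 dτ) :
    MemLp (fun τ => a τ * ψ τ) 2 dτ :=
  h.mul (Lp.memLp a)

/-- A bounded operator which commutes with the dilations is a Mellin multiplier. -/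
theorem exists_mellin_multiplier (M : L2R →L[ℂ] L2R)
    (hM : ∀ s G, M (dilation s G) = dilation s (M G)) :
    ∃ a : Lp ℂ ∞ dτ, ∀ (ψ : ℝ → ℂ) (h : MemLp ψ 2 dτ),
      M (mellinIso (h.toLp ψ)) = mellinIso ((memLp_mul_of_top a h).toLp _) := by
  -- On the Mellin side the operator commutes with modulations, and the modulations of the single
  -- vector `weight` are total.
  set M' : Lp ℂ 2 dτ →L[ℂ] Lp ℂ 2 dτ :=
    (mellinIso.symm : L2R →L[ℂ] Lp ℂ 2 dτ) ∘L M ∘L (mellinIso : Lp ℂ 2 dτ →L[ℂ] L2R) with hM'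
  have hM'' : ∀ f, mellinIso (M' f) = M (mellinIso f) := fun f => by
    simp [hM']
  have hmod : ∀ (s : ℝ), M' ((memLp_modulation memLp_weight s).toLp _) =
      (memLp_modulation (Lp.memLp (M' (memLp_weight.toLp _))) s).toLp _ := by
    intro s
    apply mellinIso.injective
    rw [hM'', mellinIso_modulation, mellinIso_modulation, hM, Lp.toLp_coeFn, hM'']
    exact Lp.memLp _
  obtain ⟨a, ha⟩ := exists_multiplier M' (memLp_weight.toLp _)
    (by filter_upwards [memLp_weight.coeFn_toLp] with τ hτ; rw [hτ]; exact weight_ne_zero τ)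
    _ span_modulation_weight (by
      rintro _ ⟨s, rfl⟩
      refine ⟨fun τ => Complex.exp ((-(s * τ) : ℝ) * Complex.I), ?_, ?_⟩
      · filter_upwards [(memLp_modulation memLp_weight s).coeFn_toLp, memLp_weight.coeFn_toLp]
          with τ h1 h2
        rw [h1, h2]
      · simp only [hmod]
        exact MemLp.coeFn_toLp _)
  refine ⟨a, fun ψ h => ?_⟩
  rw [← hM'']
  congr 1
  refine Lp.ext ?_
  filter_upwards [ha (h.toLp ψ), (memLp_mul_of_top a h).coeFn_toLp, h.coeFn_toLp] with τ h1 h2 h3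
  rw [h1, h2, h3]

/-! ### The commutant of the actions of `ℍˣ` -/

theorem L₁_L₁_inv (g : ℍ[ℝ]ˣ) (φ : L2H) : L₁ g (L₁ g⁻¹ φ) = φ := by
  refine Lp.ext ?_
  filter_upwards [L₁_apply g (L₁ g⁻¹ φ), (quasi_mul_right g).ae (L₁_apply g⁻¹ φ)] with x h1 h2
  have h3 : Real.sqrt (modulus g) * Real.sqrt (modulus (g⁻¹ : ℍ[ℝ]ˣ)) = 1 := by
    rw [← Real.sqrt_mul (modulus_pos g.ne_zero).le, ← modulus_mul, Units.mul_inv]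
    simp [modulus]
  rw [h1, h2, Units.mul_inv_cancel_right, ← mul_assoc, ← Complex.ofReal_mul, h3, Complex.ofReal_one,
    one_mul]

theorem R₁_R₁_inv (g : ℍ[ℝ]ˣ) (φ : L2H) : R₁ g (R₁ g⁻¹ φ) = φ := by
  refine Lp.ext ?_
  filter_upwards [R₁_apply g (R₁ g⁻¹ φ), (quasi_mul_left g).ae (R₁_apply g⁻¹ φ)] with x h1 h2
  have h3 : Real.sqrt (modulus g) * Real.sqrt (modulus (g⁻¹ : ℍ[ℝ]ˣ)) = 1 := by
    rw [← Real.sqrt_mul (modulus_pos g.ne_zero).le, ← modulus_mul, Units.mul_inv]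
    simp [modulus]
  rw [h1, h2, Units.inv_mul_cancel_left, ← mul_assoc, ← Complex.ofReal_mul, h3, Complex.ofReal_one,
    one_mul]

theorem inner_L₁_right (g : ℍ[ℝ]ˣ) (φ ψ : L2H) :
    inner ℂ φ (L₁ g ψ) = inner ℂ (L₁ g⁻¹ φ) ψ := by
  have h : inner ℂ (L₁ g (L₁ g⁻¹ φ)) (L₁ g ψ) = inner ℂ (L₁ g⁻¹ φ) ψ :=
    (weightedComp (modulus_pos g.ne_zero) (continuous_mul_const (g : ℍ[ℝ])).measurable
      (map_mul_right g)).inner_map_map _ _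
  rwa [L₁_L₁_inv] at h

theorem inner_R₁_right (g : ℍ[ℝ]ˣ) (φ ψ : L2H) :
    inner ℂ φ (R₁ g ψ) = inner ℂ (R₁ g⁻¹ φ) ψ := by
  have h : inner ℂ (R₁ g (R₁ g⁻¹ φ)) (R₁ g ψ) = inner ℂ (R₁ g⁻¹ φ) ψ :=
    (weightedComp (modulus_pos g.ne_zero) (continuous_const_mul (g : ℍ[ℝ])).measurable
      (map_mul_left g)).inner_map_map _ _
  rwa [R₁_R₁_inv] at h

theorem star_L₁ (g : ℍ[ℝ]ˣ) : star (L₁ g) = L₁ g⁻¹ := by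
  rw [ContinuousLinearMap.star_eq_adjoint, eq_comm, ContinuousLinearMap.eq_adjoint_iff]
  intro φ ψ
  exact (inner_L₁_right g φ ψ).symm

theorem star_R₁ (g : ℍ[ℝ]ˣ) : star (R₁ g) = R₁ g⁻¹ := by
  rw [ContinuousLinearMap.star_eq_adjoint, eq_comm, ContinuousLinearMap.eq_adjoint_iff]
  intro φ ψ
  exact (inner_R₁_right g φ ψ).symm

/-- The condition that an operator commutes with the left and right actions of `ℍˣ`. -/
def IsIntertwining (M : L2H →L[ℂ] L2H) : Prop :=
  ∀ g : ℍ[ℝ]ˣ, M ∘L L₁ g = L₁ g ∘L M ∧ M ∘L R₁ g = R₁ g ∘L M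

/-- The von Neumann algebra of the operators which commute with the actions of `ℍˣ`. -/
def intertwiningAlgebra : VonNeumannAlgebra L2H where
  toStarSubalgebra := StarSubalgebra.centralizer ℂ (Set.range L₁ ∪ Set.range R₁)
  -- The third commutant of a set equals the first.
  centralizer_centralizer' := by simp

theorem mem_intertwiningAlgebra (M : L2H →L[ℂ] L2H) :
    M ∈ intertwiningAlgebra ↔ IsIntertwining M := by
  have h : M ∈ intertwiningAlgebra ↔
      M ∈ StarSubalgebra.centralizer ℂ (Set.range L₁ ∪ Set.range R₁) := Iff.rfl
  rw [h, StarSubalgebra.mem_centralizer_iff]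
  constructor
  · intro h g
    exact ⟨(h _ (Or.inl ⟨g, rfl⟩)).1.symm, (h _ (Or.inr ⟨g, rfl⟩)).1.symm⟩
  · rintro h _ (⟨g, rfl⟩ | ⟨g, rfl⟩)
    · rw [star_L₁]
      exact ⟨(h g).1.symm, (h g⁻¹).1.symm⟩
    · rw [star_R₁]
      exact ⟨(h g).2.symm, (h g⁻¹).2.symm⟩

theorem IsIntertwining.map_L₁ {M : L2H →L[ℂ] L2H} (hM : IsIntertwining M) (g : ℍ[ℝ]ˣ) (φ : L2H) :
    M (L₁ g φ) = L₁ g (M φ) :=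
  congrArg (fun T : L2H →L[ℂ] L2H => T φ) (hM g).1

theorem IsIntertwining.map_R₁ {M : L2H →L[ℂ] L2H} (hM : IsIntertwining M) (g : ℍ[ℝ]ˣ) (φ : L2H) :
    M (R₁ g φ) = R₁ g (M φ) :=
  congrArg (fun T : L2H →L[ℂ] L2H => T φ) (hM g).2

theorem inner_leftTranslation_left (g : G₀) (F F' : L2G₀) :
    inner ℂ F (leftTranslation g F') = inner ℂ (leftTranslation g⁻¹ F) F' := by
  rw [← (leftTranslation g).inner_map_map (leftTranslation g⁻¹ F) F']
  congr 1
  refine Lp.ext ?_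
  filter_upwards [leftTranslation_coeFn g (leftTranslation g⁻¹ F),
    (measurePreserving_mul_left g).quasiMeasurePreserving.ae (leftTranslation_coeFn g⁻¹ F)]
    with x h1 h2
  rw [h1, h2, inv_mul_cancel_left]

/-- The operator on `L²(G₀)` with matrix elements `⟨F' ⊗ G', M (F ⊗ G)⟩`. -/
def angularPart (M : L2H →L[ℂ] L2H) (G' G : L2R) : L2G₀ →L[ℂ] L2G₀ :=
  ContinuousLinearMap.adjoint (tensorL.flip G') ∘L M ∘L tensorL.flip G

theorem inner_angularPart (M : L2H →L[ℂ] L2H) (G' G : L2R) (F' F : L2G₀) :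
    inner ℂ F' (angularPart M G' G F) = inner ℂ (tensor F' G') (M (tensor F G)) := by
  simp [angularPart, ContinuousLinearMap.adjoint_inner_right]

/-- For a unit quaternion `L₁` affects only the angular factor, so the translation can be passed
through `M` and across the inner product with `G` and `G'` held fixed. -/
theorem angularPart_rightTranslation {M : L2H →L[ℂ] L2H} (hM : IsIntertwining M) (G' G : L2R)
    (g : G₀) (F : L2G₀) :
    angularPart M G' G (rightTranslation g F) = rightTranslation g (angularPart M G' G F) := by
  refine ext_inner_left ℂ fun F' => ?_
  rw [inner_rightTranslation_left, inner_angularPart, inner_angularPart, ← L₁_unit_tensor,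
    hM.map_L₁, inner_L₁_right, ← map_inv, L₁_unit_tensor]

theorem angularPart_leftTranslation {M : L2H →L[ℂ] L2H} (hM : IsIntertwining M) (G' G : L2R)
    (g : G₀) (F : L2G₀) :
    angularPart M G' G (leftTranslation g F) = leftTranslation g (angularPart M G' G F) := by
  refine ext_inner_left ℂ fun F' => ?_
  rw [inner_leftTranslation_left, inner_angularPart, inner_angularPart, ← R₁_unit_tensor,
    hM.map_R₁, inner_R₁_right, ← map_inv, R₁_unit_tensor]

/-- The operator on `L²((0, ∞), du/u)` by which an intertwining operator acts on the component of
index `N`. -/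
def radialPart (M : L2H →L[ℂ] L2H) (N : ℕ) : L2R →L[ℂ] L2R :=
  (inner ℂ (matrixCoeff 0 N 0) (matrixCoeff 0 N 0))⁻¹ •
    (ContinuousLinearMap.adjoint (tensorL (matrixCoeff 0 N 0)) ∘L M ∘L tensorL (matrixCoeff 0 N 0))

/-- By `eq_smul_of_mem_W` the angular part acts on `F` by a scalar computed on `matrixCoeff 0 N 0`.
As a function of `G'` and `G` that scalar is `⟨G', radialPart M N G⟩`, so both sides have the same
inner product with every tensor. -/
theorem map_tensor {M : L2H →L[ℂ] L2H} (hM : IsIntertwining M) {N : ℕ} {F : L2G₀} (hF : F ∈ W N)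
    (G : L2R) : M (tensor F G) = tensor F (radialPart M N G) := by
  rw [← sub_eq_zero]
  refine eq_zero_of_inner_tensor _ fun F' G' => ?_
  rw [inner_sub_right, sub_eq_zero, ← inner_angularPart, inner_tensor,
    eq_smul_of_mem_W (angularPart_rightTranslation hM G' G) (angularPart_leftTranslation hM G' G) hF,
    inner_smul_right, inner_angularPart, mul_comm, div_eq_inv_mul]
  simp [radialPart, ContinuousLinearMap.adjoint_inner_right, inner_smul_right]

theorem tensor_right_injective {F : L2G₀} (hF : F ≠ 0) {G G' : L2R}
    (h : tensor F G = tensor F G') : G = G' := by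
  have h1 : tensor F (G - G') = 0 := by
    rw [← tensorL_apply, map_sub, tensorL_apply, tensorL_apply, h, sub_self]
  rw [← norm_eq_zero, norm_tensor, mul_eq_zero, norm_eq_zero, norm_eq_zero] at h1
  exact sub_eq_zero.1 (h1.resolve_left hF)

theorem radialPart_dilation {M : L2H →L[ℂ] L2H} (hM : IsIntertwining M) (N : ℕ) (s : ℝ) (G : L2R) :
    radialPart M N (dilation s G) = dilation s (radialPart M N G) := by
  have hW : matrixCoeff 0 N 0 ∈ W N := matrixCoeff_mem_W 0 N 0
  refine tensor_right_injective (matrixCoeff_zero_ne_zero N) ?_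
  rw [← map_tensor hM hW, ← L₁_expUnit_tensor, hM.map_L₁, map_tensor hM hW, L₁_expUnit_tensor]

theorem tensor_mem_component {N : ℕ} {F : L2G₀} (hF : F ∈ W N) (G : L2R) :
    tensor F G ∈ component N :=
  Submodule.le_topologicalClosure _ (Submodule.subset_span ⟨F, hF, G, rfl⟩)

theorem component_le {N : ℕ} {Q : Submodule ℂ L2H} (hQ : IsClosed (Q : Set L2H))
    (h : ∀ F ∈ W N, ∀ G : L2R, tensor F G ∈ Q) : component N ≤ Q := by
  refine Submodule.topologicalClosure_minimal _ (Submodule.span_le.2 ?_) hQ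
  rintro _ ⟨F, hF, G, rfl⟩
  exact h F hF G

theorem component_isOrtho {M N : ℕ} (h : M ≠ N) : component M ⟂ component N := by
  rw [Submodule.isOrtho_iff_le]
  refine component_le (Submodule.isClosed_orthogonal _) fun F hF G => ?_
  rw [Submodule.mem_orthogonal']
  intro φ hφ
  suffices h1 : component N ≤ (ℂ ∙ tensor F G)ᗮ from
    (Submodule.mem_orthogonal_singleton_iff_inner_right).1 (h1 hφ)
  refine component_le (Submodule.isClosed_orthogonal _) fun F' hF' G' => ?_
  rw [Submodule.mem_orthogonal_singleton_iff_inner_right, inner_tensor,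
    inner_eq_zero_of_mem_W h hF hF', zero_mul]

/-- For `φ` orthogonal to all components and fixed `G`, contracting `φ` with `G` gives a vector of
`L²(G₀)` orthogonal to every matrix coefficient, hence zero. -/
theorem iSup_component_dense : (⨆ N, component N).topologicalClosure = ⊤ := by
  rw [Submodule.topologicalClosure_eq_top_iff, Submodule.eq_bot_iff]
  intro φ hφ
  refine eq_zero_of_inner_tensor φ fun F G => ?_
  have h : ContinuousLinearMap.adjoint (tensorL.flip G) φ = 0 := by
    refine eq_zero_of_inner_matrixCoeff _ fun i k l => ?_
    rw [ContinuousLinearMap.adjoint_inner_right]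
    exact (Submodule.mem_orthogonal _ _).1 hφ _
      (Submodule.mem_iSup_of_mem (k + l) (tensor_mem_component (matrixCoeff_mem_W i k l) G))
  have h1 := ContinuousLinearMap.adjoint_inner_right (tensorL.flip G) F φ
  rw [h, inner_zero_right] at h1
  exact h1.symm

theorem eq_of_eq_on_tensor {S T : L2H →L[ℂ] L2H}
    (h : ∀ N, ∀ F ∈ W N, ∀ G, S (tensor F G) = T (tensor F G)) : S = T := by
  have hle : (⨆ N, component N).topologicalClosure ≤ LinearMap.ker (S - T).toLinearMap := by
    refine Submodule.topologicalClosure_minimal _ (iSup_le fun N => ?_) (S - T).isClosed_ker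
    refine component_le (S - T).isClosed_ker fun F hF G => ?_
    rw [LinearMap.mem_ker]
    simp [h N F hF G]
  rw [iSup_component_dense] at hle
  ext1 φ
  have h1 : φ ∈ LinearMap.ker (S - T).toLinearMap := hle trivial
  rw [LinearMap.mem_ker] at h1
  simpa [sub_eq_zero] using h1

theorem isHilbertSum_component :
    IsHilbertSum ℂ (fun N : ℕ => component N) (fun N : ℕ => (component N).subtypeₗᵢ) := by
  have : ∀ N, CompleteSpace (component N) := fun N =>
    (Submodule.isClosed_topologicalClosure _).completeSpace_coe
  refine IsHilbertSum.mkInternal _ (OrthogonalFamily.of_pairwise fun M N h => component_isOrtho h) ?_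
  rw [iSup_component_dense]

theorem commute_of_mellin_multiplier {S T : L2R →L[ℂ] L2R}
    (hS : ∀ s G, S (dilation s G) = dilation s (S G))
    (hT : ∀ s G, T (dilation s G) = dilation s (T G)) (G : L2R) : S (T G) = T (S G) := by
  obtain ⟨a, ha⟩ := exists_mellin_multiplier S hS
  obtain ⟨b, hb⟩ := exists_mellin_multiplier T hT
  obtain ⟨ψ, rfl⟩ := mellinIso.surjective G
  rw [← Lp.toLp_coeFn ψ (Lp.memLp ψ), ha, hb, ha, hb]
  congr 1
  refine MemLp.toLp_congr _ _ (Eventually.of_forall fun τ => ?_)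
  simp only
  ring

end QuaternionTate

end

open QuaternionTate
/-- `L²(ℍ, dx)` is the Hilbert sum of the components `L²((0, ∞), du/u) ⊗ W_N`; the bounded operators
on it which commute with the left and right actions of `ℍˣ` form an abelian von Neumann algebra, and
each of them acts on each component by a unique essentially bounded multiplier `a_N(τ)`. -/
theorem corollary3p10 :
    IsHilbertSum ℂ (fun N : ℕ => component N) (fun N : ℕ => (component N).subtypeₗᵢ) ∧
    ∃ 𝒜 : VonNeumannAlgebra L2H,
      (∀ M : L2H →L[ℂ] L2H, M ∈ 𝒜 ↔
        ∀ g : ℍ[ℝ]ˣ, M ∘L L₁ g = L₁ g ∘L M ∧ M ∘L R₁ g = R₁ g ∘L M) ∧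
      (∀ S ∈ 𝒜, ∀ T ∈ 𝒜, S ∘L T = T ∘L S) ∧
      ∀ M ∈ 𝒜, ∀ N : ℕ, ∃! a : Lp ℂ ∞ dτ,
        ∀ ψ : ℝ → ℂ, MemLp ψ 2 dτ → ∀ G₁ : L2R, IsMellinLim ψ G₁ →
          ∃ G₂ : L2R, IsMellinLim (fun τ => a τ * ψ τ) G₂ ∧
            ∀ F ∈ W N, M (tensor F G₁) = tensor F G₂ := by
  refine ⟨isHilbertSum_component, intertwiningAlgebra, mem_intertwiningAlgebra, ?_, ?_⟩
  · intro S hS T hT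
    rw [mem_intertwiningAlgebra] at hS hT
    refine eq_of_eq_on_tensor fun N F hF G => ?_
    rw [ContinuousLinearMap.comp_apply, ContinuousLinearMap.comp_apply, map_tensor hT hF,
      map_tensor hS hF, map_tensor hS hF, map_tensor hT hF,
      commute_of_mellin_multiplier (radialPart_dilation hS N) (radialPart_dilation hT N)]
  · intro M hM N
    rw [mem_intertwiningAlgebra] at hM
    obtain ⟨a, ha⟩ := exists_mellin_multiplier (radialPart M N) (radialPart_dilation hM N)
    refine ⟨a, ?_, ?_⟩
    · intro ψ hψ G₁ hG₁
      rw [isMellinLim_iff hψ] at hG₁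
      refine ⟨radialPart M N G₁, ?_, fun F hF => map_tensor hM hF G₁⟩
      rw [isMellinLim_iff (memLp_mul_of_top a hψ), hG₁, ha]
    · intro b hb
      -- Uniqueness needs one test function: `weight` vanishes nowhere, so its image determines the
      -- multiplier almost everywhere.
      obtain ⟨G₂, hG₂, h⟩ := hb weight memLp_weight _ ((isMellinLim_iff memLp_weight _).2 rfl)
      have hW : matrixCoeff 0 N 0 ∈ W N := matrixCoeff_mem_W 0 N 0
      have h1 := h _ hW
      rw [map_tensor hM hW] at h1
      have h2 := tensor_right_injective (matrixCoeff_zero_ne_zero N) h1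
      rw [(isMellinLim_iff (memLp_mul_of_top b memLp_weight) _).1 hG₂, ha] at h2
      have h3 := mellinIso.injective h2
      refine Lp.ext ?_
      filter_upwards [(MemLp.toLp_eq_toLp_iff _ _).1 h3] with τ hτ
      exact (mul_right_cancel₀ (weight_ne_zero τ) hτ).symm
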